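/- Let $T$ be a complete first-order theory in a language $L$ and put $|T| = |L| + \aleph_0$. Assume that $T$ is dependent (NIP). Let $\mathfrak C$ be a $\bar\kappa$-saturated model of $T$, where $\bar\kappa > 2^{|T|^{\aleph_0}}$. A type is a set of fewer than $\bar\kappa$ formulas, with parameters in $\mathfrak C$, in a fixed finite tuple $x$ of variables. For a set $\Phi$ of such formulas, $\Phi(\mathfrak C)$ is the set of its realizations in $\mathfrak C$, and $\mathrm{Dom}(\Phi)$ is the set of parameters that occur in it. Two sets of formulas are equivalent if each entails every formula of the other (modulo the elementary diagram of $\mathfrak C$). Let $p(x)$ be a type such that $G = p(\mathfrak C)$ is a group whose multiplication is definable, i.e. for some formula $\mu(x,y,z)$ with parameters in $\mathfrak C$ we have $ab = c \iff \mathfrak C \models \mu(a,b,c)$ for all $a,b,c \in G$. Let $\mathbf R$ be the set of types $r(x)$ such that $(p \cup r)(\mathfrak C)$ is a subgroup of $G$ of index $< \bar\kappa$, and let $q(x) = p(x) \cup \bigcup \{ r(x) : r \in \mathbf R\}$. Then: 1. ($\alpha$) $q(\mathfrak C)$ is a subgroup of $p(\mathfrak C)$; ($\beta$) its index is at most $2^{|T|^{\aleph_0}}$;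 ($\gamma$) there is $q' \subseteq q$ with $|q'| \le |T|^{\aleph_0}$ such that $q$ is equivalent to $p \cup q'$. Consequently there is $r \in \mathbf R$ with $(p \cup r)(\mathfrak C) = \bigcap_{r' \in \mathbf R} (p \cup r')(\mathfrak C)$: the intersection of all type-definable subgroups of bounded index ($< \bar\kappa$) is again a type-definable subgroup of bounded index. 2. If the parameters of $\mu$ lie in $\mathrm{Dom}(p)$, then there is $q' \subseteq q$ with $\mathrm{Dom}(q') \subseteq \mathrm{Dom}(p)$ and $|q'| \le |T| + |\mathrm{Dom}(p)|$ such that $q'$ is equivalent to $q$. In any case, the index of $q(\mathfrak C)$ in $p(\mathfrak C)$ is at most $2^{|\mathrm{Dom}(p)| + |T|}$. 3. If $r_i \in \mathbf R$ for all $i < (|T|^{\aleph_0})^+$, then for some $\alpha < (|T|^{\aleph_0})^+$ $$\Bigl(p \cup \bigcup_{i<\alpha} r_i\Bigr)(\mathfrak C) = \Bigl(p \cup \bigcup_{i<(|T|^{\aleph_0})^+} r_i\Bigr)(\mathfrak C).$$ -/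

import Mathlib

open FirstOrder Cardinal Set

universe u

noncomputable section

namespace Dsg

variable {L : FirstOrder.Language.{u, u}} {M : Type u} [L.Structure M]

/-- The cardinal `|T|` of a theory `T` in the language `L`: the number of first-order formulas of
the language, that is `|L| + ℵ₀`. -/
def cardT (L : FirstOrder.Language.{u, u}) : Cardinal.{u} := max ℵ₀ L.card

/-- `T` is dependent (NIP): no formula `φ(x̄; ȳ)`, with `x̄` and `ȳ` finite tuples of variables,
has the independence property. By compactness this says that there is a bound `k` such that in no
model of `T` there are `k` tuples `a i` all of whose subfamilies are cut out by some
instance `φ(x̄; b)`. -/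
def Dependent (T : L.Theory) : Prop :=
  ∀ (n m : ℕ) (φ : L.Formula (Fin n ⊕ Fin m)), ∃ k : ℕ, ∀ N : FirstOrder.Language.Theory.ModelType.{u, u, u} T,
    ¬ ∃ (a : Fin k → Fin n → N) (b : Set (Fin k) → Fin m → N),
      ∀ (i : Fin k) (S : Set (Fin k)), φ.Realize (Sum.elim (a i) (b S)) ↔ i ∈ S

variable (L M) in
/-- Formulas in the variables `X` with parameters from `M`: the free variables `Sum.inl a` stand
for the parameters `a : M`, the free variables `Sum.inr x` are the variables proper. -/
abbrev PFormula (X : Type) : Type u := L.Formula (M ⊕ X)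

/-- `M ⊨ φ[a]`, for a formula `φ` with parameters from `M`. -/
def Sat {X : Type} (φ : PFormula L M X) (a : X → M) : Prop :=
  φ.Realize (Sum.elim id a)

open Classical in
/-- The parameters that occur in a formula. -/
def params {X : Type} (φ : PFormula L M X) : Set M :=
  {c | Sum.inl c ∈ FirstOrder.Language.BoundedFormula.freeVarFinset φ}

/-- `Dom(Φ)`: the parameters that occur in a set of formulas. -/
def Dom {X : Type} (Φ : Set (PFormula L M X)) : Set M :=
  ⋃ φ ∈ Φ, params φ

/-- `Φ(M)`: the set of realizations in `M` of a set of formulas. -/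
def Sol {X : Type} (Φ : Set (PFormula L M X)) : Set (X → M) :=
  {a | ∀ φ ∈ Φ, Sat φ a}

/-- `Φ ⊢ φ`, modulo the elementary diagram of `M`. -/
def Entails {X : Type} (Φ : Set (PFormula L M X)) (φ : PFormula L M X) : Prop :=
  ∃ Φ₀ ⊆ Φ, Φ₀.Finite ∧ ∀ a : X → M, a ∈ Sol Φ₀ → Sat φ a

/-- Equivalence of two sets of formulas: each entails every formula of the other. -/
def TypeEquiv {X : Type} (Φ Ψ : Set (PFormula L M X)) : Prop :=
  (∀ ψ ∈ Ψ, Entails Φ ψ) ∧ (∀ φ ∈ Φ, Entails Ψ φ)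

variable (L M) in
/-- `M` is `κ`-saturated: every set of formulas in finitely many variables, with fewer than `κ`
parameters from `M`, which is finitely satisfiable in `M` is realized in `M`. -/
def IsSaturated (κ : Cardinal.{u}) : Prop :=
  ∀ (n : ℕ) (Φ : Set (PFormula L M (Fin n))), #(Dom Φ) < κ →
    (∀ Φ₀ ⊆ Φ, Φ₀.Finite → (Sol Φ₀).Nonempty) → (Sol Φ).Nonempty

variable {n : ℕ}

/-- The formula `μ(x, y, z)` defines, on `p(M)`, the graph of the multiplication of the
group `p(M)`. -/
def DefinesMul (p : Set (PFormula L M (Fin n))) [Group (Sol p)]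
    (μ : PFormula L M (Fin n ⊕ Fin n ⊕ Fin n)) : Prop :=
  ∀ a b c : Sol p, Sat μ (Sum.elim a.1 (Sum.elim b.1 c.1)) ↔ a * b = c

/-- The set `𝐑` of all types `r` (sets of fewer than `κ` formulas) such that `(p ∪ r)(M)` is a
subgroup of the group `p(M)` of index less than `κ`. -/
def BoundedTypes (κ : Cardinal.{u}) (p : Set (PFormula L M (Fin n))) [Group (Sol p)] :
    Set (Set (PFormula L M (Fin n))) :=
  {r | #r < κ ∧ ∃ H : Subgroup (Sol p),
    Subtype.val '' (H : Set (Sol p)) = Sol (p ∪ r) ∧ #(Sol p ⧸ H) < κ}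

/-- The set of formulas `q = p ∪ ⋃ 𝐑`. -/
def qType (κ : Cardinal.{u}) (p : Set (PFormula L M (Fin n))) [Group (Sol p)] :
    Set (PFormula L M (Fin n)) :=
  p ∪ ⋃₀ BoundedTypes κ p

end Dsg

end

set_option linter.unusedSectionVars false

noncomputable section

namespace Dsg

open FirstOrder.Language Filter

/-! ### Formulas with parameters, definable sets, saturation. -/

variable {L : FirstOrder.Language.{u, u}} {M : Type u} [L.Structure M]

/-! By compactness, each type `r` in 𝐑 satisfies a condition checked formula by formula,
`BoundedSystem`: a formula ψ of `r` contains the quotients of solutions in G of some finite s ⊆ r,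
and G has a finite coloring such that x y⁻¹ satisfies ψ whenever x and y have the same color
(`boundedSystem_of_mem`). This condition is stable under unions, each formula already lies in a
countable subsystem, and the index is at most 2^(ℵ₀·|r|). It therefore suffices to find few
countable systems with the same intersection as all of them.

NIP provides them (`Dependent.exists_small_subfamily`). Otherwise there are elements b_j lying in
the subgroup H_i for every i < j, but far from H_j. The pigeonhole principle on colors selects pairs
whose quotients a_j lie outside a neighbourhood D_j of H_j and close to all other H_i. Products of
the a_j then realize every membership pattern in the D_j (`exists_shattered`), although the D_j are
instances of one formula. Only |T| choices of a formula and a number of colors arise, so |T|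
countable systems suffice. Both index bounds follow from the resulting bound 2^|T|, and
stabilization follows from regularity of a successor cardinal.

For definability over Dom(p), the candidate consists of the formulas of q over Dom(p). A realization
a of it has the same type over Dom(p) as some b in q(M). Conjugating a countable system along a ↦ b
gives a bounded system again; b satisfies the conjugate, hence a satisfies the original
(`mem_sol_of_sameType`). -/

open Classical in
/-- Renaming the free variables of a formula along a function. -/
def rename {α β : Type*} (g : α → β) (φ : L.Formula α) : L.Formula β :=
  BoundedFormula.restrictFreeVar φ (fun x => g x)

theorem realize_rename {α β : Type*} (g : α → β) (φ : L.Formula α) (v : β → M) :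
    (rename g φ).Realize v ↔ φ.Realize (v ∘ g) := by
  classical
  exact BoundedFormula.realize_restrictFreeVar _ (by simp)

open Classical in
theorem mem_varFinsetLeft_restrictVarLeft {α β γ : Type*} (t : L.Term (α ⊕ γ))
    (f : t.varFinsetLeft → β) {b : β} (hb : b ∈ (t.restrictVarLeft f).varFinsetLeft) :
    ∃ a, f a = b := by
  induction t with
  | var x =>
    cases x with
    | inl a => exact ⟨_, by simpa [Term.restrictVarLeft, eq_comm] using hb⟩
    | inr a => simp [Term.restrictVarLeft] at hb
  | func F ts ih =>
    simp only [Term.restrictVarLeft, Term.varFinsetLeft, Finset.mem_biUnion] at hb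
    obtain ⟨i, -, hi⟩ := hb
    obtain ⟨a, ha⟩ := ih i _ hi
    exact ⟨_, ha⟩

open Classical in
theorem mem_freeVarFinset_restrictFreeVar {α β : Type*} {n : ℕ} (φ : L.BoundedFormula α n)
    (f : φ.freeVarFinset → β) {b : β} (hb : b ∈ (φ.restrictFreeVar f).freeVarFinset) :
    ∃ a, f a = b := by
  induction φ with
  | falsum => simp [BoundedFormula.restrictFreeVar] at hb
  | equal t₁ t₂ =>
    simp only [BoundedFormula.restrictFreeVar, BoundedFormula.freeVarFinset,
      Finset.mem_union] at hb
    rcases hb with hb | hb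
    all_goals
      obtain ⟨a, ha⟩ := mem_varFinsetLeft_restrictVarLeft _ _ hb
      exact ⟨_, ha⟩
  | rel R ts =>
    simp only [BoundedFormula.restrictFreeVar, BoundedFormula.freeVarFinset,
      Finset.mem_biUnion] at hb
    obtain ⟨i, -, hi⟩ := hb
    obtain ⟨a, ha⟩ := mem_varFinsetLeft_restrictVarLeft _ _ hi
    exact ⟨_, ha⟩
  | imp φ₁ φ₂ ih₁ ih₂ =>
    simp only [BoundedFormula.restrictFreeVar, BoundedFormula.freeVarFinset,
      Finset.mem_union] at hb
    rcases hb with hb | hb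
    · obtain ⟨a, ha⟩ := ih₁ _ hb
      exact ⟨_, ha⟩
    · obtain ⟨a, ha⟩ := ih₂ _ hb
      exact ⟨_, ha⟩
  | all φ ih =>
    simp only [BoundedFormula.restrictFreeVar, BoundedFormula.freeVarFinset] at hb
    exact ih _ hb

open Classical in
theorem mem_freeVarFinset_rename {α β : Type*} (g : α → β) (φ : L.Formula α) {b : β}
    (hb : b ∈ BoundedFormula.freeVarFinset (rename g φ)) :
    ∃ a ∈ BoundedFormula.freeVarFinset φ, g a = b := by
  obtain ⟨a, ha⟩ := mem_freeVarFinset_restrictFreeVar _ _ hb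
  exact ⟨a, a.2, ha⟩

/-- A formula over `A`, seen as a formula with parameters in `M`. -/
def ofFormula (A : Set M) {X : Type} (φ : L.Formula (A ⊕ X)) : PFormula L M X :=
  rename (Sum.map Subtype.val id) φ

theorem sat_ofFormula (A : Set M) {X : Type} (φ : L.Formula (A ⊕ X)) (v : X → M) :
    Sat (ofFormula A φ) v ↔ φ.Realize (Sum.elim (↑) v) := by
  rw [Sat, ofFormula, realize_rename, Sum.elim_comp_map]
  rfl

theorem params_ofFormula (A : Set M) {X : Type} (φ : L.Formula (A ⊕ X)) :
    params (ofFormula A φ) ⊆ A := by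
  intro c hc
  simp only [params, mem_ofPred_eq] at hc
  obtain ⟨a, -, ha⟩ := mem_freeVarFinset_rename (Sum.map Subtype.val id) φ
    (b := Sum.inl c) (by rw [ofFormula] at hc; convert hc)
  cases a with
  | inl a => exact (Sum.inl_injective ha) ▸ a.2
  | inr a => simp at ha

theorem exists_ofFormula {A : Set M} {X : Type} {D : Set (X → M)} (hD : A.Definable L D) :
    ∃ φ : L.Formula (A ⊕ X), ∀ v, Sat (ofFormula A φ) v ↔ v ∈ D := by
  obtain ⟨φ, rfl⟩ := definable_iff_exists_formula_sum.1 hD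
  exact ⟨φ, sat_ofFormula A φ⟩

theorem params_finite {X : Type} (φ : PFormula L M X) : (params φ).Finite := by
  classical
  refine Finite.preimage Sum.inl_injective.injOn
    (BoundedFormula.freeVarFinset φ).finite_toSet |>.subset ?_
  intro c hc
  simp only [params, mem_ofPred_eq] at hc
  simp only [mem_preimage, Finset.mem_coe]
  convert hc

theorem definable_sat {X : Type} (φ : PFormula L M X) :
    (params φ).Definable L {v | Sat φ v} := by
  classical
  refine definable_iff_exists_formula_sum.2 ⟨BoundedFormula.restrictFreeVar φ (fun x =>
    Sum.casesOn (motive := fun y => y = x.1 → params φ ⊕ X) x.1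
      (fun c h => Sum.inl ⟨c, by
        have := x.2
        rw [← h] at this
        simp only [params, mem_ofPred_eq]
        convert this⟩) (fun y _ => Sum.inr y) rfl), ?_⟩
  ext v
  simp only [Sat, mem_ofPred_eq]
  refine (BoundedFormula.realize_restrictFreeVar (Sum.elim id v) ?_).symm
  rintro ⟨a | a, ha⟩ <;> rfl

theorem definable_sat_of_subset {X : Type} {φ : PFormula L M X} {A : Set M}
    (h : params φ ⊆ A) : A.Definable L {v | Sat φ v} :=
  (definable_sat φ).mono h

theorem params_subset_dom {X : Type} {Φ : Set (PFormula L M X)} {φ : PFormula L M X}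
    (h : φ ∈ Φ) : params φ ⊆ Dom Φ :=
  subset_biUnion_of_mem (u := fun φ => params φ) h

theorem dom_mono {X : Type} {Φ Ψ : Set (PFormula L M X)} (h : Φ ⊆ Ψ) : Dom Φ ⊆ Dom Ψ :=
  biUnion_subset_biUnion_left h

theorem definable_sol {X : Type} {Φ : Set (PFormula L M X)} (hΦ : Φ.Finite) {A : Set M}
    (h : Dom Φ ⊆ A) : A.Definable L (Sol Φ) := by
  have : Finite Φ := hΦ
  have : Sol Φ = ⋂ φ : Φ, {v | Sat φ.1 v} := by
    ext v
    simp [Sol]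
  rw [this]
  exact definable_iInter_of_finite fun φ =>
    definable_sat_of_subset ((params_subset_dom φ.2).trans h)

theorem definable_substitute {A : Set M} {J ι : Type*} {D : Set (J ⊕ ι → M)}
    (hD : A.Definable L D) (c : J → M) :
    (A ∪ range c).Definable L {v : ι → M | Sum.elim c v ∈ D} := by
  obtain ⟨φ, rfl⟩ := definable_iff_exists_formula_sum.1 hD
  refine definable_iff_exists_formula_sum.2 ⟨rename
    (Sum.elim (fun a : A => Sum.inl ⟨a.1, Or.inl a.2⟩) (Sum.map (fun j => ⟨c j, Or.inr ⟨j, rfl⟩⟩) id)) φ, ?_⟩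
  ext v
  simp only [mem_ofPred_eq, realize_rename]
  refine iff_of_eq (congrArg _ ?_)
  ext x
  rcases x with x | x | x <;> rfl

/-- Compactness in filter form: the formulas over `A` that hold eventually along `F` are finitely
satisfiable. -/
theorem IsSaturated.exists_realization {κ : Cardinal.{u}} (hM : IsSaturated L M κ)
    {β ι : Type*} [Finite ι] (F : Filter β) [NeBot F] (f : β → ι → M) {A : Set M}
    (hA : #A < κ) :
    ∃ v, ∀ D, A.Definable L D → (∀ᶠ b in F, f b ∈ D) → v ∈ D := by
  obtain ⟨N, ⟨e⟩⟩ := Finite.exists_equiv_fin ι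
  let Φ : Set (PFormula L M (Fin N)) :=
    {φ | params φ ⊆ A ∧ ∀ᶠ b in F, Sat φ (f b ∘ e.symm)}
  obtain ⟨w, hw⟩ := hM N Φ
    ((mk_le_mk_of_subset (iUnion₂_subset fun φ hφ => hφ.1)).trans_lt hA) (by
      intro Φ₀ h₀ hfin
      have : ∀ᶠ b in F, ∀ φ ∈ Φ₀, Sat φ (f b ∘ e.symm) :=
        (eventually_all_finite hfin).2 fun φ hφ => (h₀ hφ).2
      obtain ⟨v, hv⟩ := this.exists
      exact ⟨_, hv⟩)
  refine ⟨w ∘ e, fun D hD hDF => ?_⟩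
  obtain ⟨φ, hφ⟩ := exists_ofFormula (hD.preimage_comp e)
  refine (hφ w).1 (hw _ ⟨params_ofFormula A φ, ?_⟩)
  filter_upwards [hDF] with v hv
  rw [hφ]
  simpa [Function.comp_assoc] using hv

/-- If `c` realizes over `A` a family of tuples `f` along a filter, and each tuple `f b` is
completed by a finite tuple `g b`, then `c` can be completed accordingly. -/
theorem IsSaturated.exists_extension {κ : Cardinal.{u}} (hM : IsSaturated L M κ)
    {β J ι : Type*} [Finite ι] (F : Filter β) (f : β → J → M) (g : β → ι → M) {A : Set M}
    (c : J → M) (hA : #(A ∪ range c : Set M) < κ)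
    (hc : ∀ D, A.Definable L D → (∀ᶠ b in F, f b ∈ D) → c ∈ D) :
    ∃ v : ι → M, ∀ D, A.Definable L D → (∀ᶠ b in F, Sum.elim (f b) (g b) ∈ D) →
      Sum.elim c v ∈ D := by
  let F' : Filter (ι → M) :=
    { sets := {S | ∃ D, A.Definable L D ∧ (∀ᶠ b in F, Sum.elim (f b) (g b) ∈ D) ∧
        {v | Sum.elim c v ∈ D} ⊆ S}
      univ_sets := ⟨univ, definable_univ, univ_mem, subset_univ _⟩
      sets_of_superset := by
        rintro S S' ⟨D, h1, h2, h3⟩ h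
        exact ⟨D, h1, h2, h3.trans h⟩
      inter_sets := by
        rintro S S' ⟨D, h1, h2, h3⟩ ⟨D', h1', h2', h3'⟩
        exact ⟨D ∩ D', h1.inter h1', inter_mem h2 h2', fun v hv => ⟨h3 hv.1, h3' hv.2⟩⟩ }
  -- The projection of `D` is definable over `A` and holds eventually at `f`, hence at `c`, so the
  -- fibre of `D` over `c` is nonempty.
  have hF' : NeBot F' := by
    refine ⟨fun hbot => ?_⟩
    obtain ⟨D, h1, h2, h3⟩ := (hbot ▸ mem_bot : ∅ ∈ F')
    obtain ⟨v, hv⟩ := hc _ h1.exists_of_finite (by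
      filter_upwards [h2] with b hb
      exact ⟨g b, hb⟩)
    exact h3 hv
  obtain ⟨v, hv⟩ := hM.exists_realization F' id hA
  exact ⟨v, fun D hdef hD => hv {v | Sum.elim c v ∈ D} (definable_substitute hdef c)
    ⟨D, hdef, hD, subset_rfl⟩⟩

theorem mk_union_lt {κ : Cardinal.{u}} (hκ : ℵ₀ ≤ κ) {α : Type u} {A B : Set α} (hA : #A < κ)
    (hB : #B < κ) : #(A ∪ B : Set α) < κ :=
  (mk_union_le A B).trans_lt (add_lt_of_lt hκ hA hB)

theorem mk_lt_of_finite {κ : Cardinal.{u}} (hκ : ℵ₀ ≤ κ) {α : Type u} {A : Set α}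
    (hA : A.Finite) : #A < κ :=
  hA.lt_aleph0.trans_le hκ

theorem mk_iUnion_finite_lt {κ : Cardinal.{u}} (hκ : ℵ₀ < κ) {α β : Type u} {f : α → Set β}
    (hα : #α < κ) (hf : ∀ a, (f a).Finite) : #(⋃ a, f a) < κ := by
  refine (mk_iUnion_le f).trans_lt (mul_lt_of_lt hκ.le hα (lt_of_le_of_lt ?_ hκ))
  exact ciSup_le' fun a => (hf a).lt_aleph0.le

theorem mk_dom_lt {κ : Cardinal.{u}} (hκ : ℵ₀ < κ) {X : Type} {Φ : Set (PFormula L M X)}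
    (hΦ : #Φ < κ) : #(Dom Φ) < κ := by
  rw [Dom, biUnion_eq_iUnion]
  exact mk_iUnion_finite_lt hκ hΦ fun φ => params_finite φ.1

theorem sol_union {X : Type} (Φ Ψ : Set (PFormula L M X)) : Sol (Φ ∪ Ψ) = Sol Φ ∩ Sol Ψ := by
  ext v
  simp only [Sol, mem_union, mem_ofPred_eq, mem_inter_iff]
  exact ⟨fun h => ⟨fun φ hφ => h φ (Or.inl hφ), fun φ hφ => h φ (Or.inr hφ)⟩,
    fun h φ hφ => hφ.elim (h.1 φ) (h.2 φ)⟩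

theorem sol_anti {X : Type} {Φ Ψ : Set (PFormula L M X)} (h : Φ ⊆ Ψ) : Sol Ψ ⊆ Sol Φ :=
  fun _ hv φ hφ => hv φ (h hφ)

theorem IsSaturated.entails {κ : Cardinal.{u}} (hM : IsSaturated L M κ) (hκ : ℵ₀ < κ) {n : ℕ}
    {Φ : Set (PFormula L M (Fin n))} (hΦ : #(Dom Φ) < κ) {φ : PFormula L M (Fin n)}
    (h : ∀ v ∈ Sol Φ, Sat φ v) : Entails Φ φ := by
  classical
  by_contra hcon
  have hex : ∀ s : Finset Φ, ∃ v, v ∈ Sol (Subtype.val '' (s : Set Φ)) ∧ ¬ Sat φ v := by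
    intro s
    by_contra! hs
    exact hcon ⟨_, by rintro _ ⟨x, -, rfl⟩; exact x.2, s.finite_toSet.image _, hs⟩
  choose v hv hφ using hex
  obtain ⟨w, hw⟩ := hM.exists_realization atTop v (A := Dom Φ ∪ params φ)
    (mk_union_lt hκ.le hΦ (mk_lt_of_finite hκ.le (params_finite φ)))
  refine hw {w | Sat φ w}ᶜ (definable_sat_of_subset subset_union_right).compl
    (Eventually.of_forall hφ) (h w fun ψ hψ => ?_)
  refine hw {w | Sat ψ w}
    (definable_sat_of_subset ((params_subset_dom hψ).trans subset_union_left)) ?_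
  filter_upwards [eventually_ge_atTop {⟨ψ, hψ⟩}] with s hs
  exact hv s ψ ⟨⟨ψ, hψ⟩, by simpa using hs, rfl⟩

/-! ### Bounded systems. -/

variable {n : ℕ}

/-- A set of formulas which cuts out a subgroup of `p(M)` of bounded index for formula-by-formula
reasons: each formula contains the quotients of solutions of finitely many of the formulas, and is
coarsely closed with respect to a partition of the group into finitely many pieces. -/
structure BoundedSystem (p : Set (PFormula L M (Fin n))) [Group (Sol p)]
    (r : Set (PFormula L M (Fin n))) : Prop where
  div : ∀ ψ ∈ r, ∃ s ⊆ r, s.Finite ∧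
    ∀ x y : Sol p, x.1 ∈ Sol s → y.1 ∈ Sol s → Sat ψ (x * y⁻¹).1
  color : ∀ ψ ∈ r, ∃ (k : ℕ) (χ : Sol p → Fin k), ∀ x y, χ x = χ y → Sat ψ (x * y⁻¹).1

/-- The filter on the group `p(M)` generated by the formulas of `r`. -/
def nhd (p r : Set (PFormula L M (Fin n))) : Filter (Sol p) where
  sets := {D | ∃ s ⊆ r, s.Finite ∧ ∀ x : Sol p, x.1 ∈ Sol s → x ∈ D}
  univ_sets := ⟨∅, empty_subset _, finite_empty, fun _ _ => mem_univ _⟩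
  sets_of_superset := by
    rintro D E ⟨s, h1, h2, h3⟩ h
    exact ⟨s, h1, h2, fun x hx => h (h3 x hx)⟩
  inter_sets := by
    rintro D E ⟨s, h1, h2, h3⟩ ⟨t, h1', h2', h3'⟩
    refine ⟨s ∪ t, union_subset h1 h1', h2.union h2', fun x hx => ?_⟩
    rw [sol_union] at hx
    exact ⟨h3 x hx.1, h3' x hx.2⟩

theorem mem_nhd {p r : Set (PFormula L M (Fin n))} {D : Set (Sol p)} :
    D ∈ nhd p r ↔ ∃ s ⊆ r, s.Finite ∧ ∀ x : Sol p, x.1 ∈ Sol s → x ∈ D :=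
  Iff.rfl

theorem sol_mem_nhd {p r s : Set (PFormula L M (Fin n))} (hs : s ⊆ r) (hfin : s.Finite) :
    {x : Sol p | x.1 ∈ Sol s} ∈ nhd p r :=
  ⟨s, hs, hfin, fun _ hx => hx⟩

theorem sat_mem_nhd {p r : Set (PFormula L M (Fin n))} {ψ : PFormula L M (Fin n)} (hψ : ψ ∈ r) :
    {x : Sol p | Sat ψ x.1} ∈ nhd p r :=
  ⟨{ψ}, by simpa using hψ, finite_singleton ψ, fun _ hx => hx ψ rfl⟩

theorem mem_of_mem_nhd {p r : Set (PFormula L M (Fin n))} {D : Set (Sol p)} (hD : D ∈ nhd p r)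
    {x : Sol p} (hx : x.1 ∈ Sol r) : x ∈ D := by
  obtain ⟨s, h1, -, h3⟩ := mem_nhd.1 hD
  exact h3 x (sol_anti h1 hx)

namespace BoundedSystem

variable {p : Set (PFormula L M (Fin n))} [Group (Sol p)] {r : Set (PFormula L M (Fin n))}

theorem exists_div_subset (h : BoundedSystem p r) {D : Set (Sol p)} (hD : D ∈ nhd p r) :
    ∃ E ∈ nhd p r, ∀ x ∈ E, ∀ y ∈ E, x * y⁻¹ ∈ D := by
  obtain ⟨s, hs, hfin, hsD⟩ := mem_nhd.1 hD
  choose! t htr htfin ht using h.div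
  refine ⟨_, sol_mem_nhd (s := ⋃ ψ ∈ s, t ψ) (iUnion₂_subset fun ψ hψ => htr ψ (hs hψ))
    (hfin.biUnion fun ψ hψ => htfin ψ (hs hψ)), fun x hx y hy => hsD _ fun ψ hψ => ?_⟩
  have hsub : t ψ ⊆ ⋃ ψ ∈ s, t ψ := subset_biUnion_of_mem (u := t) hψ
  exact ht ψ (hs hψ) x y (sol_anti hsub hx) (sol_anti hsub hy)

theorem exists_color (h : BoundedSystem p r) {D : Set (Sol p)} (hD : D ∈ nhd p r) :
    ∃ (k : ℕ) (χ : Sol p → Fin k), ∀ x y, χ x = χ y → x * y⁻¹ ∈ D := by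
  obtain ⟨s, hs, hfin, hsD⟩ := mem_nhd.1 hD
  have := hfin.to_subtype
  choose k χ hχ using h.color
  obtain ⟨N, ⟨e⟩⟩ := Finite.exists_equiv_fin (∀ ψ : s, Fin (k ψ.1 (hs ψ.2)))
  refine ⟨N, fun x => e fun ψ => χ ψ.1 (hs ψ.2) x, fun x y hxy => hsD _ fun ψ hψ => ?_⟩
  exact hχ ψ (hs hψ) x y (congrFun (e.injective hxy) ⟨ψ, hψ⟩)

theorem one_mem (h : BoundedSystem p r) : (1 : Sol p).1 ∈ Sol r := by
  intro ψ hψ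
  obtain ⟨k, χ, hχ⟩ := h.color ψ hψ
  simpa using hχ 1 1 rfl

theorem div_mem (h : BoundedSystem p r) {x y : Sol p} (hx : x.1 ∈ Sol r) (hy : y.1 ∈ Sol r) :
    (x * y⁻¹).1 ∈ Sol r := by
  intro ψ hψ
  obtain ⟨s, hs, -, h⟩ := h.div ψ hψ
  exact h x y (sol_anti hs hx) (sol_anti hs hy)

/-- The subgroup cut out by a bounded system. -/
def subgroup (h : BoundedSystem p r) : Subgroup (Sol p) :=
  Subgroup.ofDiv {x | x.1 ∈ Sol r} ⟨1, h.one_mem⟩ fun _ hx _ hy => h.div_mem hx hy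

theorem mem_subgroup (h : BoundedSystem p r) {x : Sol p} : x ∈ h.subgroup ↔ x.1 ∈ Sol r :=
  Iff.rfl

theorem image_subgroup (h : BoundedSystem p r) :
    Subtype.val '' (h.subgroup : Set (Sol p)) = Sol (p ∪ r) := by
  rw [sol_union]
  ext v
  constructor
  · rintro ⟨x, hx, rfl⟩
    exact ⟨x.2, hx⟩
  · rintro ⟨h1, h2⟩
    exact ⟨⟨v, h1⟩, h2, rfl⟩

/-- A coset is determined by the colors of one representative for all formulas of `r`. The inverse
is colored because colors control x y⁻¹, while left cosets are compared by x⁻¹ y. -/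
theorem mk_quotient_le (h : BoundedSystem p r) :
    #(Sol p ⧸ h.subgroup) ≤ 2 ^ (ℵ₀ * #r) := by
  choose k χ hχ using h.color
  have hinj : Function.Injective (fun (q : Sol p ⧸ h.subgroup) (ψ : r) =>
      (χ ψ.1 ψ.2 (Quotient.out q)⁻¹ : ℕ)) := by
    intro q q' hq
    rw [← Quotient.out_eq' q, ← Quotient.out_eq' q']
    refine QuotientGroup.eq.2 (h.mem_subgroup.2 fun ψ hψ => ?_)
    simpa using hχ ψ hψ _ _ (Fin.ext (congrFun hq ⟨ψ, hψ⟩))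
  refine (mk_le_of_injective hinj).trans ?_
  rw [power_mul, two_power_aleph0, mk_arrow, mk_nat]
  simpa using power_le_power_right (aleph0_le_continuum)

theorem mem_boundedTypes (h : BoundedSystem p r) {κ : Cardinal.{u}}
    (hκ : 2 ^ (ℵ₀ * #r) < κ) (hr : #r < κ) : r ∈ BoundedTypes κ p :=
  ⟨hr, h.subgroup, h.image_subgroup, h.mk_quotient_le.trans_lt hκ⟩

theorem sUnion {S : Set (Set (PFormula L M (Fin n)))} (h : ∀ r ∈ S, BoundedSystem p r) :
    BoundedSystem p (⋃₀ S) where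
  div := by
    rintro ψ ⟨r, hr, hψ⟩
    obtain ⟨s, hs, h1, h2⟩ := (h r hr).div ψ hψ
    exact ⟨s, hs.trans (subset_sUnion_of_mem hr), h1, h2⟩
  color := by
    rintro ψ ⟨r, hr, hψ⟩
    exact (h r hr).color ψ hψ

/-- Close {ψ} under the choice of finite sets in `div`, in ω steps; `color` concerns single formulas
and is inherited. -/
theorem exists_countable (h : BoundedSystem p r) {ψ : PFormula L M (Fin n)} (hψ : ψ ∈ r) :
    ∃ r₁ ⊆ r, r₁.Countable ∧ ψ ∈ r₁ ∧ BoundedSystem p r₁ := by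
  choose! t htr htfin ht using h.div
  let S : ℕ → Set (PFormula L M (Fin n)) := fun k => Nat.rec {ψ} (fun _ s => ⋃ φ ∈ s, t φ) k
  have hS : ∀ k, S k ⊆ r ∧ (S k).Countable := by
    intro k
    induction k with
    | zero => exact ⟨by simpa [S] using hψ, countable_singleton ψ⟩
    | succ k ih =>
      exact ⟨iUnion₂_subset fun φ hφ => htr φ (ih.1 hφ),
        ih.2.biUnion fun φ hφ => (htfin φ (ih.1 hφ)).countable⟩
  refine ⟨⋃ k, S k, iUnion_subset fun k => (hS k).1, countable_iUnion fun k => (hS k).2,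
    mem_iUnion.2 ⟨0, rfl⟩, ?_, ?_⟩
  · intro φ hφ
    obtain ⟨k, hk⟩ := mem_iUnion.1 hφ
    have hφr := (hS k).1 hk
    refine ⟨t φ, ?_, htfin φ hφr, ht φ hφr⟩
    exact (subset_biUnion_of_mem (u := t) hk).trans (subset_iUnion S (k + 1))
  · intro φ hφ
    obtain ⟨k, hk⟩ := mem_iUnion.1 hφ
    exact h.color φ ((hS k).1 hk)

end BoundedSystem

/-! ### Compactness: types in 𝐑 are bounded systems. -/

section ofMem

variable {κ : Cardinal.{u}} (hM : IsSaturated L M κ) (hκ : ℵ₀ < κ)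
  {p : Set (PFormula L M (Fin n))} (hp : #p < κ) [Group (Sol p)]
  {μ : PFormula L M (Fin n ⊕ Fin n ⊕ Fin n)} (hμ : DefinesMul p μ)
  {r : Set (PFormula L M (Fin n))} (hr : #r < κ)

include hM hκ hp hμ hr

theorem exists_finite_div {H : Subgroup (Sol p)} (hH : ∀ x, x ∈ H ↔ x.1 ∈ Sol r)
    {ψ : PFormula L M (Fin n)} (hψ : ψ ∈ r) :
    ∃ s ⊆ r, s.Finite ∧ ∀ x y : Sol p, x.1 ∈ Sol s → y.1 ∈ Sol s → Sat ψ (x * y⁻¹).1 := by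
  by_contra! hcon
  let F₀ : Filter (Sol p × Sol p) :=
    (nhd p r ×ˢ nhd p r) ⊓ 𝓟 {w | ¬ Sat ψ (w.1 * w.2⁻¹).1}
  have : NeBot F₀ := by
    refine inf_principal_neBot_iff.2 fun U hU => ?_
    obtain ⟨t, ht, htU⟩ := mem_prod_same_iff.1 hU
    obtain ⟨s, hs, hfin, hst⟩ := mem_nhd.1 ht
    obtain ⟨x, y, hx, hy, hxy⟩ := hcon s hs hfin
    exact ⟨(x, y), htU ⟨hst x hx, hst y hy⟩, hxy⟩
  let A := Dom p ∪ Dom r ∪ params μ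
  have hA : #A < κ := mk_union_lt hκ.le (mk_union_lt hκ.le (mk_dom_lt hκ hp) (mk_dom_lt hκ hr))
    (mk_lt_of_finite hκ.le (params_finite μ))
  -- The quotient is realized together with `y` and `x`, so that `μ` forces z y = x in the limit.
  obtain ⟨v, hv⟩ := hM.exists_realization F₀ (fun w : Sol p × Sol p =>
    Sum.elim (w.1 * w.2⁻¹).1 (Sum.elim w.2.1 w.1.1)) hA
  have hpA : ∀ φ ∈ p, params φ ⊆ A := fun φ hφ =>
    (params_subset_dom hφ).trans (subset_union_left.trans subset_union_left)
  have hrA : ∀ φ ∈ r, params φ ⊆ A := fun φ hφ =>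
    (params_subset_dom hφ).trans (subset_union_right.trans subset_union_left)
  let z : Sol p := ⟨v ∘ Sum.inl, fun φ hφ => hv _
    ((definable_sat_of_subset (hpA φ hφ)).preimage_comp Sum.inl)
    (Eventually.of_forall fun w => (w.1 * w.2⁻¹).2 φ hφ)⟩
  let y : Sol p := ⟨v ∘ Sum.inr ∘ Sum.inl, fun φ hφ => hv _
    ((definable_sat_of_subset (hpA φ hφ)).preimage_comp (Sum.inr ∘ Sum.inl))
    (Eventually.of_forall fun w => w.2.2 φ hφ)⟩
  let x : Sol p := ⟨v ∘ Sum.inr ∘ Sum.inr, fun φ hφ => hv _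
    ((definable_sat_of_subset (hpA φ hφ)).preimage_comp (Sum.inr ∘ Sum.inr))
    (Eventually.of_forall fun w => w.1.2 φ hφ)⟩
  have hx : x ∈ H := (hH x).2 fun φ hφ => by
    refine hv _ ((definable_sat_of_subset (hrA φ hφ)).preimage_comp (Sum.inr ∘ Sum.inr)) ?_
    exact mem_inf_of_left (prod_mem_prod (sat_mem_nhd hφ) univ_mem |> fun h =>
      mem_of_superset h fun w hw => hw.1)
  have hy : y ∈ H := (hH y).2 fun φ hφ => by
    refine hv _ ((definable_sat_of_subset (hrA φ hφ)).preimage_comp (Sum.inr ∘ Sum.inl)) ?_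
    exact mem_inf_of_left (prod_mem_prod univ_mem (sat_mem_nhd hφ) |> fun h =>
      mem_of_superset h fun w hw => hw.2)
  have hz : ¬ Sat ψ z.1 := by
    refine hv _ ((definable_sat_of_subset (hrA ψ hψ)).compl.preimage_comp Sum.inl) ?_
    exact mem_inf_of_right fun w hw => hw
  have hmul : Sat μ v := by
    exact hv {v | Sat μ v} (definable_sat_of_subset subset_union_right)
      (Eventually.of_forall fun w => (hμ _ _ _).2 (by group))
  have hzy : z * y = x := by
    rw [← hμ]
    convert hmul
    ext i
    rcases i with i | i | i <;> rfl
  rw [← eq_mul_inv_iff_mul_eq] at hzy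
  exact hz ((hH z).1 (hzy ▸ H.mul_mem hx (H.inv_mem hy)) ψ hψ)

theorem exists_finite_cover {H : Subgroup (Sol p)} (hH : ∀ x, x ∈ H ↔ x.1 ∈ Sol r)
    (hindex : #(Sol p ⧸ H) < κ) {s : Set (PFormula L M (Fin n))} (hs : s ⊆ r)
    (hfin : s.Finite) : ∃ T : Finset (Sol p), ∀ x, ∃ g ∈ T, (x * g⁻¹).1 ∈ Sol s := by
  classical
  by_contra! hcon
  -- Inverses of left coset representatives represent the right cosets.
  let f : Sol p ⧸ H → Sol p := fun q => (Quotient.out q)⁻¹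
  have hf : ∀ x, ∃ q, x * (f q)⁻¹ ∈ H := fun x => by
    refine ⟨((x⁻¹ : Sol p) : Sol p ⧸ H), ?_⟩
    have : (((x⁻¹ : Sol p) : Sol p ⧸ H).out : Sol p ⧸ H) = (x⁻¹ : Sol p) :=
      Quotient.out_eq' _
    have h := QuotientGroup.eq.1 this.symm
    simpa [f] using h
  choose x hx using fun T : Finset (Sol p ⧸ H) => hcon (T.image f)
  have hev : ∀ q, ∀ᶠ T in atTop, (x T * (f q)⁻¹).1 ∉ Sol s := fun q => by
    filter_upwards [eventually_ge_atTop {q}] with T hT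
    exact hx T _ (Finset.mem_image_of_mem f (by simpa using hT))
  let B : Set M := ⋃ q, range (f q).1
  let A := Dom p ∪ Dom r ∪ params μ ∪ B
  have hA : #A < κ := mk_union_lt hκ.le (mk_union_lt hκ.le
    (mk_union_lt hκ.le (mk_dom_lt hκ hp) (mk_dom_lt hκ hr))
    (mk_lt_of_finite hκ.le (params_finite μ)))
    (mk_iUnion_finite_lt hκ hindex fun q => finite_range _)
  have hpA : ∀ φ ∈ p, params φ ⊆ A := fun φ hφ =>
    (params_subset_dom hφ).trans fun a ha => Or.inl (Or.inl (Or.inl ha))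
  have hrA : Dom r ⊆ A := fun a ha => Or.inl (Or.inl (Or.inr ha))
  obtain ⟨v, hv⟩ := hM.exists_realization atTop (fun T => (x T).1) hA
  let v' : Sol p := ⟨v, fun φ hφ => hv {v | Sat φ v}
    (definable_sat_of_subset (hpA φ hφ)) (Eventually.of_forall fun T => (x T).2 φ hφ)⟩
  obtain ⟨q, hq⟩ := hf v'
  -- The coset of the limit `v` is known only now, so the quotient by its representative is added by
  -- a second realization. It lies in `H` but outside `Sol s`.
  obtain ⟨w, hw⟩ := hM.exists_extension atTop (fun T => (x T).1)
    (fun T => (x T * (f q)⁻¹).1) v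
    (mk_union_lt hκ.le hA (mk_lt_of_finite hκ.le (finite_range v))) hv
  let w' : Sol p := ⟨w, fun φ hφ => hw {u | Sat φ (u ∘ Sum.inr)}
    ((definable_sat_of_subset (hpA φ hφ)).preimage_comp Sum.inr)
    (Eventually.of_forall fun T => (x T * (f q)⁻¹).2 φ hφ)⟩
  have hws : w ∉ Sol s := by
    exact hw ((fun u => u ∘ Sum.inr) ⁻¹' (Sol s)ᶜ) ((definable_sol hfin
      ((dom_mono hs).trans hrA)).compl.preimage_comp Sum.inr) (hev q)
  have hmul : Sat μ (Sum.elim w (Sum.elim (f q).1 v)) := by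
    have hdef : A.Definable L {u : Fin n ⊕ Fin n → M |
        Sum.elim (f q).1 u ∈ (fun t : Fin n ⊕ Fin n ⊕ Fin n → M =>
          t ∘ (Sum.elim (Sum.inr ∘ Sum.inr) (Sum.elim Sum.inl (Sum.inr ∘ Sum.inl)))) ⁻¹'
            {t | Sat μ t}} := by
      refine (definable_substitute (A := A)
        ((definable_sat_of_subset fun a ha => Or.inl (Or.inr ha)).preimage_comp _) _).mono ?_
      exact union_subset subset_rfl fun a ha => Or.inr (mem_iUnion.2 ⟨q, ha⟩)
    have key : ∀ a b : Fin n → M, Sum.elim (f q).1 (Sum.elim b a) ∘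
        (Sum.elim (Sum.inr ∘ Sum.inr) (Sum.elim Sum.inl (Sum.inr ∘ Sum.inl))) =
          Sum.elim a (Sum.elim (f q).1 b) := by
      intro a b
      ext i
      rcases i with i | i | i <;> rfl
    have := hw _ hdef (Eventually.of_forall fun T => ?_)
    · rw [← key]
      exact this
    · simp only [mem_ofPred_eq, mem_preimage, key]
      exact (hμ _ _ _).2 (by group)
  have hwv : w' * f q = v' := (hμ _ _ _).1 hmul
  rw [← eq_mul_inv_iff_mul_eq] at hwv
  exact hws (sol_anti hs ((hH w').1 (hwv ▸ hq)))

omit hr in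
theorem boundedSystem_of_mem (hr : r ∈ BoundedTypes κ p) : BoundedSystem p r := by
  obtain ⟨hr, H, himage, hindex⟩ := hr
  have hH : ∀ x, x ∈ H ↔ x.1 ∈ Sol r := by
    intro x
    have : x.1 ∈ Subtype.val '' (H : Set (Sol p)) ↔ x.1 ∈ Sol (p ∪ r) := by rw [himage]
    rw [sol_union] at this
    simpa using this
  have hdiv := fun ψ (hψ : ψ ∈ r) => exists_finite_div hM hκ hp hμ hr hH hψ
  refine ⟨hdiv, fun ψ hψ => ?_⟩
  obtain ⟨s, hs, hfin, h⟩ := hdiv ψ hψ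
  obtain ⟨T, hT⟩ := exists_finite_cover hM hκ hp hμ hr hH hindex hs hfin
  choose g hgT hg using hT
  refine ⟨T.card, fun x => T.equivFin ⟨g x, hgT x⟩, fun x y hxy => ?_⟩
  have hgxy : g x = g y := by simpa using hxy
  have := h _ _ (hg x) (hgxy ▸ hg y)
  simpa using this

end ofMem

/-! ### NIP: few systems determine the intersection. -/

/-- Choosing, from the top block of indices to the bottom one, two indices in each block which
get the same colors from the indices chosen in the higher blocks. -/
theorem exists_pairs_same_color {G : Type*} (m k : ℕ) (b : ℕ → G) (χ : ℕ → G → Fin k) :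
    ∃ β α : ℕ → ℕ, ∀ j < m, j * (k ^ m + 1) ≤ β j ∧ β j < α j ∧ α j < (j + 1) * (k ^ m + 1) ∧
      ∀ l, j < l → l < m → χ (β l) (b (β j)) = χ (β l) (b (α j)) := by
  suffices h : ∀ t, ∃ β α : ℕ → ℕ, ∀ j < m, m ≤ j + t →
      j * (k ^ m + 1) ≤ β j ∧ β j < α j ∧ α j < (j + 1) * (k ^ m + 1) ∧
      ∀ l, j < l → l < m → χ (β l) (b (β j)) = χ (β l) (b (α j)) by
    obtain ⟨β, α, h⟩ := h m
    exact ⟨β, α, fun j hj => h j hj (by omega)⟩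
  intro t
  induction t with
  | zero => exact ⟨id, id, fun j hj hj' => by omega⟩
  | succ t ih =>
    obtain ⟨β, α, h⟩ := ih
    by_cases htm : m ≤ t
    · exact ⟨β, α, fun j hj _ => h j hj (by omega)⟩
    obtain ⟨j₀, hj₀⟩ : ∃ j₀, m = j₀ + t + 1 := ⟨m - t - 1, by omega⟩
    -- There are k^m color vectors, fewer than the block size. Coordinates of blocks not yet treated
    -- carry irrelevant values of `β`.
    obtain ⟨x, y, hxy, heq⟩ : ∃ x y : Fin (k ^ m + 1), x < y ∧
        ∀ l : Fin m, χ (β l) (b (j₀ * (k ^ m + 1) + x)) =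
          χ (β l) (b (j₀ * (k ^ m + 1) + y)) := by
      obtain ⟨x, y, hne, heq⟩ := Fintype.exists_ne_map_eq_of_card_lt
        (fun (x : Fin (k ^ m + 1)) (l : Fin m) => χ (β l) (b (j₀ * (k ^ m + 1) + x))) (by simp)
      rcases lt_or_gt_of_ne hne with hlt | hlt
      · exact ⟨x, y, hlt, fun l => congrFun heq l⟩
      · exact ⟨y, x, hlt, fun l => (congrFun heq l).symm⟩
    refine ⟨Function.update β j₀ (j₀ * (k ^ m + 1) + x),
      Function.update α j₀ (j₀ * (k ^ m + 1) + y), fun j hj hjt => ?_⟩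
    have hl : ∀ l, j < l → l ≠ j₀ := by omega
    rcases eq_or_ne j j₀ with rfl | hne
    · simp only [Function.update_self]
      refine ⟨by omega, by simpa using hxy, ?_, fun l hjl hlm => ?_⟩
      · have := y.2
        rw [add_mul, one_mul]
        omega
      · rw [Function.update_of_ne (hl l hjl)]
        exact heq ⟨l, hlm⟩
    · obtain ⟨h1, h2, h3, h4⟩ := h j hj (by omega)
      simp only [Function.update_of_ne hne]
      refine ⟨h1, h2, h3, fun l hjl hlm => ?_⟩
      rw [Function.update_of_ne (hl l hjl)]
      exact h4 l hjl hlm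

/-- From a long sequence of elements `b j`, lying in the subgroups `H i` for `i < j` and far away
from `H j`, we get elements whose membership in some of the neighbourhoods `D i` of the `H i` is
arbitrarily prescribed. -/
theorem exists_shattered {G : Type*} [Group G] (m k : ℕ) (H D E : ℕ → Set G) (b : ℕ → G)
    (χ : ℕ → G → Fin k)
    (hb : ∀ i j, i < j → b j ∈ H i) (hdiv : ∀ i, ∀ x ∈ H i, ∀ y ∈ H i, x * y⁻¹ ∈ H i)
    (hHD : ∀ i, H i ⊆ D i) (hHE : ∀ i, H i ⊆ E i)
    (hED : ∀ i (l : List G), l.length ≤ m → (∀ x ∈ l, x ∈ E i) → l.prod ∈ D i)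
    (hbD : ∀ i, ∀ w ∈ D i, ∀ x ∈ D i, ∀ y ∈ D i, ∀ z ∈ D i, w⁻¹ * x * y⁻¹ * z ≠ b i)
    (hχ : ∀ i x y, χ i x = χ i y → x * y⁻¹ ∈ E i) :
    ∃ β : Fin m → ℕ, ∀ u : Set (Fin m), ∃ g, ∀ j, g ∈ D (β j) ↔ j ∈ u := by
  classical
  obtain ⟨β, α, h⟩ := exists_pairs_same_color m k b χ
  let a : Fin m → G := fun j => b (β j) * (b (α j))⁻¹
  -- For i < j this is equality of colors; for i > j both factors lie in the subgroup `H (β j)`.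
  have ha : ∀ i j : Fin m, i ≠ j → a i ∈ E (β j) := by
    intro i j hij
    obtain ⟨h1, h2, h3, h4⟩ := h i i.2
    rcases lt_or_gt_of_ne hij with hlt | hlt
    · exact hχ _ _ _ (h4 j hlt j.2)
    · obtain ⟨h1', h2', h3', -⟩ := h j j.2
      have hle : ((j : ℕ) + 1) * (k ^ m + 1) ≤ i * (k ^ m + 1) :=
        Nat.mul_le_mul_right _ hlt
      exact hHE _ (hdiv _ _ (hb _ _ (by omega)) _ (hb _ _ (by omega)))
  refine ⟨fun j => β j, fun u => ⟨(((List.finRange m).filter (· ∉ u)).map a).prod,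
    fun j => ?_⟩⟩
  constructor
  · intro hD
    by_contra hj
    obtain ⟨l₁, l₂, hl⟩ := List.mem_iff_append.1 (List.mem_finRange j)
    have hnodup := List.nodup_finRange m
    rw [hl] at hnodup
    have hlen : l₁.length + l₂.length + 1 = m := by
      have := congrArg List.length hl
      simp at this
      omega
    have hside : ∀ l : List (Fin m), j ∉ l → l.length ≤ m →
        ((l.filter (· ∉ u)).map a).prod ∈ D (β j) := by
      intro l hjl hl
      refine hED _ _ ?_ ?_
      · rw [List.length_map]
        exact (List.length_filter_le _ _).trans hl
      · intro x hx
        obtain ⟨i, hi, rfl⟩ := List.mem_map.1 hx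
        exact ha i j fun hij => hjl (hij ▸ (List.mem_filter.1 hi).1)
    have h₁ := hside l₁ (by grind) (by omega)
    have h₂ := hside l₂ (by grind) (by omega)
    rw [hl] at hD
    simp only [List.filter_append, List.map_append, List.prod_append, List.filter_cons, hj,
      not_false_eq_true, decide_true, if_true, List.map_cons, List.prod_cons] at hD
    -- If P₁ a_j P₂ = g were in D, then b (β j) = P₁⁻¹ g P₂⁻¹ b (α j) would be one of the excluded
    -- fourfold products.
    refine hbD (β j) _ h₁ _ hD _ h₂ (b (α j)) (hHD _ (hb _ _ (h j j.2).2.1)) ?_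
    simp only [a]
    group
  · intro hj
    refine hED _ _ ?_ ?_
    · rw [List.length_map]
      exact (List.length_filter_le _ _).trans (List.length_finRange).le
    · intro x hx
      obtain ⟨i, hi, rfl⟩ := List.mem_map.1 hx
      refine ha i j fun hij => ?_
      have := (List.mem_filter.1 hi).2
      simp only [decide_eq_true_eq] at this
      exact this (hij ▸ hj)

namespace BoundedSystem

variable {p : Set (PFormula L M (Fin n))} [Group (Sol p)] {r : Set (PFormula L M (Fin n))}

theorem exists_mul_subset (h : BoundedSystem p r) {D : Set (Sol p)} (hD : D ∈ nhd p r) :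
    ∃ E ∈ nhd p r, ∀ x ∈ E, ∀ y ∈ E, x * y ∈ D := by
  obtain ⟨E, hE, hED⟩ := h.exists_div_subset hD
  obtain ⟨E', hE', hE'E⟩ := h.exists_div_subset hE
  refine ⟨E ∩ E', inter_mem hE hE', fun x hx y hy => ?_⟩
  have := hED x hx.1 _ (hE'E 1 (mem_of_mem_nhd hE' h.one_mem) y hy.2)
  simpa using this

theorem exists_list_prod_subset (h : BoundedSystem p r) {D : Set (Sol p)} (hD : D ∈ nhd p r)
    (m : ℕ) : ∃ E ∈ nhd p r, ∀ l : List (Sol p), l.length ≤ m → (∀ x ∈ l, x ∈ E) →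
      l.prod ∈ D := by
  induction m generalizing D with
  | zero =>
    refine ⟨D, hD, fun l hl _ => ?_⟩
    rw [List.length_eq_zero_iff.1 (Nat.le_zero.1 hl)]
    exact mem_of_mem_nhd hD h.one_mem
  | succ m ih =>
    obtain ⟨E, hE, hED⟩ := h.exists_mul_subset hD
    obtain ⟨E', hE', hE'E⟩ := ih hE
    refine ⟨E ∩ E', inter_mem hE hE', fun l hl hlE => ?_⟩
    cases l with
    | nil => exact mem_of_mem_nhd hD h.one_mem
    | cons x l =>
      rw [List.prod_cons]
      refine hED x (hlE x (by simp)).1 _ (hE'E l (by simpa using hl) fun y hy => ?_)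
      exact (hlE y (by simp [hy])).2

theorem exists_quadruple_subset (h : BoundedSystem p r) {D : Set (Sol p)} (hD : D ∈ nhd p r) :
    ∃ E ∈ nhd p r, ∀ w ∈ E, ∀ x ∈ E, ∀ y ∈ E, ∀ z ∈ E, w⁻¹ * x * y⁻¹ * z ∈ D := by
  obtain ⟨E₁, hE₁, h₁⟩ := h.exists_div_subset hD
  obtain ⟨E₂, hE₂, h₂⟩ := h.exists_div_subset hE₁
  obtain ⟨E₃, hE₃, h₃⟩ := h.exists_div_subset hE₂
  have hinv : ∀ x ∈ E₃, x⁻¹ ∈ E₂ := fun x hx => by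
    simpa using h₃ 1 (mem_of_mem_nhd hE₃ h.one_mem) x hx
  refine ⟨E₃, hE₃, fun w hw x hx y hy z hz => ?_⟩
  have := h₁ _ (h₂ _ (hinv w hw) _ (hinv x hx)) _ (h₂ _ (hinv z hz) _ (hinv y hy))
  simpa [mul_assoc] using this

end BoundedSystem

/-- The formula `φ(c, x)` cuts out a neighbourhood `D` of the subgroup defined by `r`, such that
products of four elements of `D` or their inverses satisfy `ψ`, and `D` contains all products of
`K` elements of another neighbourhood for which there is a coloring of the group with `k` colors. -/
def HasPattern (p : Set (PFormula L M (Fin n))) [Group (Sol p)]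
    (r : Set (PFormula L M (Fin n))) (ψ : PFormula L M (Fin n)) (K m k : ℕ)
    (φ : L.Formula (Fin m ⊕ Fin n)) : Prop :=
  ∃ (c : Fin m → M) (D E : Set (Sol p)) (χ : Sol p → Fin k),
    (∀ x, x ∈ D ↔ φ.Realize (Sum.elim c x.1)) ∧
    (∀ x, x.1 ∈ Sol r → x ∈ D) ∧ (∀ x, x.1 ∈ Sol r → x ∈ E) ∧
    (∀ l : List (Sol p), l.length ≤ K → (∀ x ∈ l, x ∈ E) → l.prod ∈ D) ∧
    (∀ w ∈ D, ∀ x ∈ D, ∀ y ∈ D, ∀ z ∈ D, Sat ψ (w⁻¹ * x * y⁻¹ * z).1) ∧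
    ∀ x y, χ x = χ y → x * y⁻¹ ∈ E

theorem exists_formula_fin {A : Set M} {D : Set (Fin n → M)} (hD : A.Definable L D) :
    ∃ (m : ℕ) (φ : L.Formula (Fin m ⊕ Fin n)) (c : Fin m → M),
      ∀ v, v ∈ D ↔ φ.Realize (Sum.elim c v) := by
  obtain ⟨A₀, -, hA₀⟩ := definable_iff_finitely_definable.1 hD
  obtain ⟨φ, rfl⟩ := definable_iff_exists_formula_sum.1 hA₀
  refine ⟨A₀.card, rename (Sum.map A₀.equivFin id) φ, fun i => A₀.equivFin.symm i, fun v => ?_⟩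
  rw [realize_rename, Sum.elim_comp_map]
  simp only [mem_ofPred_eq, Function.comp_id]
  refine iff_of_eq (congrArg (fun t => φ.Realize (Sum.elim t v)) ?_)
  ext x
  exact congrArg Subtype.val (A₀.equivFin.symm_apply_apply x).symm

/-- The order of choices matters: first φ, then the NIP bound K of φ, then a neighbourhood E whose
K-fold products stay in D, and only then the number of colors for E. -/
theorem BoundedSystem.exists_hasPattern {p : Set (PFormula L M (Fin n))} [Group (Sol p)]
    {r : Set (PFormula L M (Fin n))} (h : BoundedSystem p r) {ψ : PFormula L M (Fin n)}
    (hψ : ψ ∈ r) (K : ∀ m, L.Formula (Fin m ⊕ Fin n) → ℕ) :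
    ∃ m φ k, HasPattern p r ψ (K m φ) m k φ := by
  obtain ⟨D', hD', h4⟩ := h.exists_quadruple_subset (sat_mem_nhd hψ)
  obtain ⟨s, hs, hfin, hsD⟩ := mem_nhd.1 hD'
  obtain ⟨m, φ, c, hφ⟩ := exists_formula_fin (definable_sol hfin subset_rfl)
  have hD := sol_mem_nhd (p := p) hs hfin
  obtain ⟨E, hE, hED⟩ := h.exists_list_prod_subset hD (K m φ)
  obtain ⟨k, χ, hχ⟩ := h.exists_color hE
  exact ⟨m, φ, k, c, _, E, χ, fun x => hφ x.1, fun x hx => mem_of_mem_nhd hD hx,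
    fun x hx => mem_of_mem_nhd hE hx, hED, fun w hw x hx y hy z hz =>
      h4 w (hsD w hw) x (hsD x hx) y (hsD y hy) z (hsD z hz), hχ⟩

theorem false_of_hasPattern_seq {p : Set (PFormula L M (Fin n))} [Group (Sol p)]
    {r : ℕ → Set (PFormula L M (Fin n))} (hr : ∀ i, BoundedSystem p (r i))
    {ψ : ℕ → PFormula L M (Fin n)} {b : ℕ → Sol p} {K m k : ℕ} {φ : L.Formula (Fin m ⊕ Fin n)}
    (hK : ¬ ∃ (c : Fin K → Fin m → M) (g : Set (Fin K) → Fin n → M),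
      ∀ (i : Fin K) (S : Set (Fin K)), φ.Realize (Sum.elim (c i) (g S)) ↔ i ∈ S)
    (hpat : ∀ i, HasPattern p (r i) (ψ i) K m k φ)
    (hb : ∀ i j, i < j → (b j).1 ∈ Sol (r i)) (hψ : ∀ i, ¬ Sat (ψ i) (b i).1) : False := by
  choose c D E χ hD hrD hrE hED h4 hχ using hpat
  obtain ⟨β, hβ⟩ := exists_shattered K k (fun i => {x : Sol p | x.1 ∈ Sol (r i)}) D E b χ hb
    (fun i x hx y hy => (hr i).div_mem hx hy) hrD hrE hED
    (fun i w hw x hx y hy z hz heq => hψ i (heq ▸ h4 i w hw x hx y hy z hz)) hχ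
  choose g hg using hβ
  exact hK ⟨fun i => c (β i), fun u => (g u).1, fun i u => (hD _ _).symm.trans (hg u i)⟩

theorem mk_formula_le (m : ℕ) : #(L.Formula (Fin m ⊕ Fin n)) ≤ cardT L := by
  have h1 : #(L.Formula (Fin m ⊕ Fin n)) ≤ #(Σ k, L.BoundedFormula (Fin m ⊕ Fin n) k) :=
    mk_le_of_injective (f := fun φ => ⟨0, φ⟩) fun φ φ' h => by simpa using h
  refine h1.trans (BoundedFormula.card_le.trans ?_)
  have hT : ℵ₀ ≤ cardT L := le_max_left _ _
  refine max_le hT (add_le_of_le hT ?_ ?_)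
  · refine le_trans ?_ hT
    simp
  · simp [cardT]

theorem mk_sigma_formula_le :
    #(Σ m, L.Formula (Fin m ⊕ Fin n) × ℕ) ≤ cardT L := by
  have hT : ℵ₀ ≤ cardT L := le_max_left _ _
  rw [mk_sigma]
  refine (sum_le_lift_mk_mul_iSup _).trans (mul_le_of_le hT (by simpa using hT) ?_)
  refine ciSup_le' fun m => ?_
  rw [mk_prod]
  refine mul_le_of_le hT ?_ (by simpa using hT)
  simpa using mk_formula_le m

/-- For each triple (m, φ, k), finitely many members of `R` imply, on the group, all formulas with
that pattern; otherwise a recursively built sequence contradicts `false_of_hasPattern_seq`. There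
are at most |T| triples. -/
theorem Dependent.exists_small_subfamily {T : L.Theory} (hT : Dependent T) [Nonempty M] [M ⊨ T]
    {p : Set (PFormula L M (Fin n))} [Group (Sol p)] (R : Set (Set (PFormula L M (Fin n))))
    (hR : ∀ r ∈ R, BoundedSystem p r) :
    ∃ S ⊆ R, #S ≤ cardT L ∧ Sol (p ∪ ⋃₀ S) = Sol (p ∪ ⋃₀ R) := by
  classical
  choose K hK using fun m φ => hT m n φ
  have hfin : ∀ σ : Σ m, L.Formula (Fin m ⊕ Fin n) × ℕ, ∃ S : Finset (Set (PFormula L M (Fin n))),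
      (S : Set _) ⊆ R ∧ ∀ r ∈ R, ∀ ψ ∈ r, HasPattern p r ψ (K σ.1 σ.2.1) σ.1 σ.2.2 σ.2.1 →
        ∀ x : Sol p, (∀ r' ∈ S, x.1 ∈ Sol r') → Sat ψ x.1 := by
    rintro ⟨m, φ, k⟩
    by_contra! hcon
    obtain ⟨f, hf, hf'⟩ := exists_seq_of_forall_finset_exists
      (α := Set (PFormula L M (Fin n)) × PFormula L M (Fin n) × Sol p)
      (fun t => t.1 ∈ R ∧ HasPattern p t.1 t.2.1 (K m φ) m k φ ∧ ¬ Sat t.2.1 t.2.2.1)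
      (fun t t' => t'.2.2.1 ∈ Sol t.1) (by
        intro s hs
        obtain ⟨r, hrR, ψ, -, hpat, x, hx, hxψ⟩ := hcon (s.image Prod.fst) (by
          intro r hr
          simp only [Finset.coe_image, mem_image, Finset.mem_coe] at hr
          obtain ⟨t, ht, rfl⟩ := hr
          exact (hs t ht).1)
        exact ⟨(r, ψ, x), ⟨hrR, hpat, hxψ⟩, fun t ht => hx _ (Finset.mem_image_of_mem _ ht)⟩)
    exact false_of_hasPattern_seq (fun i => hR _ (hf i).1) (hK m φ (Theory.ModelType.of T M))
      (fun i => (hf i).2.1) hf' (fun i => (hf i).2.2)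
  choose S hSR hS using hfin
  refine ⟨⋃ σ, (S σ : Set (Set (PFormula L M (Fin n)))), iUnion_subset hSR, ?_, ?_⟩
  · have hT : ℵ₀ ≤ cardT L := le_max_left _ _
    refine (mk_iUnion_le _).trans (mul_le_of_le hT mk_sigma_formula_le ?_)
    exact ciSup_le' fun σ => (S σ).finite_toSet.lt_aleph0.le.trans hT
  · refine Subset.antisymm (fun v hv => ?_) (sol_anti (union_subset_union_right _
      (sUnion_subset_sUnion (iUnion_subset hSR))))
    rw [sol_union] at hv ⊢
    refine ⟨hv.1, ?_⟩
    rintro ψ ⟨r, hr, hψ⟩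
    obtain ⟨m, φ, k, hpat⟩ := (hR r hr).exists_hasPattern hψ K
    exact hS ⟨m, φ, k⟩ r hr ψ hψ hpat ⟨v, hv.1⟩ fun r' hr' => sol_anti
      (subset_sUnion_of_mem (mem_iUnion.2 ⟨⟨m, φ, k⟩, hr'⟩)) hv.2

/-! ### Conjugating countable systems over a small set. -/

/-- `w` satisfies all the formulas over `A` that `v` satisfies. -/
def SameType (L : FirstOrder.Language.{u, u}) [L.Structure M] (A : Set M) {ι : Type*}
    (v w : ι → M) : Prop :=
  ∀ D, A.Definable L D → v ∈ D → w ∈ D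

namespace SameType

variable {A : Set M} {ι J : Type*} {v w : ι → M}

theorem symm (h : SameType L A v w) : SameType L A w v := fun D hD hw => by
  by_contra hv
  exact h Dᶜ hD.compl hv hw

theorem mem_iff (h : SameType L A v w) {D : Set (ι → M)} (hD : A.Definable L D) :
    v ∈ D ↔ w ∈ D :=
  ⟨h D hD, h.symm D hD⟩

theorem comp (h : SameType L A v w) (f : J → ι) : SameType L A (v ∘ f) (w ∘ f) :=
  fun _ hD hv => h _ (hD.preimage_comp f) hv

theorem exists_extension [Finite J] (h : SameType L A v w) {κ : Cardinal.{u}}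
    (hM : IsSaturated L M κ) (hA : #(A ∪ range w : Set M) < κ) (v' : J → M) :
    ∃ w' : J → M, SameType L A (Sum.elim v v') (Sum.elim w w') := by
  obtain ⟨w', hw'⟩ := hM.exists_extension (pure ()) (fun _ => v) (fun _ => v') w hA
    (fun D hD hv => h D hD (by simpa using hv))
  exact ⟨w', fun D hD hv => hw' D hD (by simpa using hv)⟩

end SameType

open Classical in
theorem realize_congr_of_freeVarFinset {α : Type*} (φ : L.Formula α) {v w : α → M}
    (h : ∀ a ∈ BoundedFormula.freeVarFinset φ, v a = w a) : φ.Realize v ↔ φ.Realize w :=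
  (BoundedFormula.realize_restrictFreeVar (f := fun a => a.1) (v := w) v
    fun a => (h a a.2).symm).symm.trans
  (BoundedFormula.realize_restrictFreeVar w fun _ => rfl)

theorem exists_fin_support {A : Set M} {n : ℕ} {D : Set (ℕ ⊕ Fin n → M)}
    (hD : A.Definable L D) : ∃ (k : ℕ) (D' : Set (Fin k ⊕ Fin n → M)), A.Definable L D' ∧
      ∀ v, v ∈ D ↔ v ∘ Sum.map Fin.val id ∈ D' := by
  classical
  obtain ⟨φ, rfl⟩ := definable_iff_exists_formula_sum.1 hD
  -- All indices that occur are at most `k`, so reduction modulo k + 1 does not change them.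
  let s : Finset ℕ := (BoundedFormula.freeVarFinset φ).toRight.toLeft
  let k := s.sup id
  have hk : ∀ i, Sum.inr (Sum.inl i) ∈ BoundedFormula.freeVarFinset φ → i ≤ k := fun i hi =>
    Finset.le_sup (f := id) (by simpa [s] using hi)
  let f : A ⊕ (ℕ ⊕ Fin n) → A ⊕ (Fin (k + 1) ⊕ Fin n) :=
    Sum.map id (Sum.map (Fin.ofNat (k + 1)) id)
  refine ⟨k + 1, _, definable_iff_exists_formula_sum.2
    ⟨BoundedFormula.restrictFreeVar φ (fun x => f x), rfl⟩, fun v => ?_⟩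
  refine (BoundedFormula.realize_restrictFreeVar (Sum.elim (Subtype.val : A → M) v) ?_).symm
  rintro ⟨x | i | x, hx⟩
  · rfl
  · have : i % (k + 1) = i := Nat.mod_eq_of_lt (Nat.lt_succ_of_le (hk i hx))
    simp [f, this]
  · rfl

/-- Saturation handles finite tuples only, so the sequence is moved one entry at a time; a definable
condition sees only finitely many entries. -/
theorem SameType.exists_seq_extension {κ : Cardinal.{u}} (hκ : ℵ₀ ≤ κ) (hM : IsSaturated L M κ)
    {A : Set M} (hA : #A < κ) {n : ℕ} {a b : Fin n → M} (hab : SameType L A a b) (c : ℕ → M) :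
    ∃ c' : ℕ → M, SameType L A (Sum.elim c a) (Sum.elim c' b) := by
  let P : ℕ → (ℕ → M) → Prop := fun k g => SameType L A
    (Sum.elim (fun i : Fin k => c i) a) (Sum.elim (fun i : Fin k => g i) b)
  have key : ∀ (k : ℕ) (g : ℕ → M) (y : M) (z : Fin n → M),
      (Sum.elim (fun i : Fin (k + 1) => Function.update g k y i) z) =
      Sum.elim (Sum.elim (fun i : Fin k => g i) z) (fun _ : Unit => y) ∘
        Sum.elim (Fin.lastCases (Sum.inr ()) (fun i => Sum.inl (Sum.inl i)))
          (fun i => Sum.inl (Sum.inr i)) := by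
    intro k g y z
    ext i
    rcases i with i | i
    · cases i using Fin.lastCases with
      | last => simp
      | cast i => simp [i.2.ne]
    · rfl
  have hstep : ∀ k g, P k g → ∃ y, P (k + 1) (Function.update g k y) := by
    intro k g hg
    obtain ⟨w', hw'⟩ := SameType.exists_extension hg hM
      (mk_union_lt hκ hA (mk_lt_of_finite hκ (finite_range _))) (fun _ : Unit => c k)
    refine ⟨w' (), ?_⟩
    have h1 := key k c (c k) a
    rw [Function.update_eq_self] at h1
    simp only [P]
    rw [h1, key]
    exact hw'.comp _
  have : Nonempty M := ⟨c 0⟩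
  choose! y hy using hstep
  let G : ℕ → ℕ → M := fun k => Nat.rec c (fun k g => Function.update g k (y k g)) k
  have hG : ∀ k, G (k + 1) = Function.update (G k) k (y k (G k)) := fun k => rfl
  have hP : ∀ k, P k (G k) := by
    intro k
    induction k with
    | zero =>
      have := hab.comp (Sum.elim (fun i : Fin 0 => i.elim0) id)
      convert this using 1
      all_goals
        ext i
        rcases i with i | i
        · exact i.elim0
        · rfl
    | succ k ih => exact hy k _ ih
  have hstab : ∀ i k, i < k → G k i = G (i + 1) i := by
    intro i k hik
    induction k, hik using Nat.le_induction with
    | base => rfl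
    | succ k hk ih => rw [hG, Function.update_of_ne (by omega), ih]
  refine ⟨fun i => G (i + 1) i, fun D hD hca => ?_⟩
  obtain ⟨k, D', hD', hk⟩ := exists_fin_support hD
  rw [hk] at hca ⊢
  rw [Sum.elim_comp_map, Function.comp_id] at hca ⊢
  have := hP k D' hD' hca
  convert this using 2
  ext i
  exact (hstab i k i.2).symm

section Conjugate

variable {κ : Cardinal.{u}} (hκ : ℵ₀ < κ) (hM : IsSaturated L M κ)
  {p : Set (PFormula L M (Fin n))} [Group (Sol p)]
  {μ : PFormula L M (Fin n ⊕ Fin n ⊕ Fin n)} (hμ : DefinesMul p μ)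
  {A : Set M} (hA : #A < κ) (hpA : Dom p ⊆ A) (hμA : params μ ⊆ A)

include hκ hM hμ hA hpA hμA

/-- All elements and their quotients are moved as one tuple; since `μ` is over `A`, quotients go to
quotients. -/
theorem SameType.exists_group_tuple {c c' : ℕ → M} (hc : SameType L A c c') {ι : Type*}
    [Finite ι] (x : ι → Sol p) :
    ∃ x' : ι → Sol p, (∀ i, SameType L A (Sum.elim c (x i).1) (Sum.elim c' (x' i).1)) ∧
      ∀ i j, SameType L A (Sum.elim c (x i * (x j)⁻¹).1) (Sum.elim c' (x' i * (x' j)⁻¹).1) := by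
  let X : ι ⊕ ι × ι → Sol p := Sum.elim x fun ij => x ij.1 * (x ij.2)⁻¹
  obtain ⟨v, hv⟩ := hc.exists_extension (J := (ι ⊕ ι × ι) × Fin n) hM
    (lt_of_le_of_lt (mk_union_le _ _) (add_lt_of_lt hκ.le hA (lt_of_le_of_lt
      (by simpa using mk_range_le_lift (f := c')) hκ))) (fun t => (X t.1).1 t.2)
  have hX : ∀ t, SameType L A (Sum.elim c (X t).1) (Sum.elim c' fun k => v (t, k)) := by
    intro t
    have := hv.comp (Sum.map id fun k : Fin n => (t, k))
    rwa [Sum.elim_comp_map, Sum.elim_comp_map] at this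
  have hvp : ∀ t, (fun k => v (t, k)) ∈ Sol p := by
    intro t φ hφ
    exact (hX t).comp Sum.inr {v | Sat φ v}
      (definable_sat_of_subset ((params_subset_dom hφ).trans hpA)) ((X t).2 φ hφ)
  let X' : ι ⊕ ι × ι → Sol p := fun t => ⟨_, hvp t⟩
  have hmul : ∀ i j, X' (Sum.inr (i, j)) = X' (Sum.inl i) * (X' (Sum.inl j))⁻¹ := by
    intro i j
    rw [eq_mul_inv_iff_mul_eq, ← hμ]
    have key : ∀ w : (ι ⊕ ι × ι) × Fin n → M, ∀ u : ℕ → M,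
        Sum.elim u w ∘ Sum.elim (fun k : Fin n => Sum.inr (Sum.inr (i, j), k))
          (Sum.elim (fun k : Fin n => Sum.inr (Sum.inl j, k))
            (fun k : Fin n => Sum.inr (Sum.inl i, k))) =
        Sum.elim (fun k => w (Sum.inr (i, j), k))
          (Sum.elim (fun k => w (Sum.inl j, k)) (fun k => w (Sum.inl i, k))) := by
      intro w u
      ext k
      rcases k with k | k | k <;> rfl
    have h := hv.comp (Sum.elim (fun k : Fin n => Sum.inr (Sum.inr (i, j), k))
          (Sum.elim (fun k : Fin n => Sum.inr (Sum.inl j, k))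
            (fun k : Fin n => Sum.inr (Sum.inl i, k))))
    rw [key, key] at h
    exact h {v | Sat μ v} (definable_sat_of_subset hμA)
      ((hμ (x i * (x j)⁻¹) (x j) (x i)).2 (by group))
  refine ⟨fun i => X' (Sum.inl i), fun i => hX (Sum.inl i), fun i j => ?_⟩
  rw [← hmul]
  exact hX (Sum.inr (i, j))

-- The formula and its conjugate are fibres of the same definable set, over `c` and over `c'`.
omit hκ hM hμ hA hpA hμA [Group (Sol p)] in
theorem exists_definable_of_params_subset_range (c c' : ℕ → M) (f : M → ℕ) (A : Set M)
    {ψ : PFormula L M (Fin n)} (hf : ∀ a ∈ params ψ, c (f a) = a) :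
    ∃ D : Set (ℕ ⊕ Fin n → M), A.Definable L D ∧
      (∀ v, Sat ψ v ↔ Sum.elim c v ∈ D) ∧
      ∀ v, Sat (rename (Sum.map (c' ∘ f) id) ψ) v ↔ Sum.elim c' v ∈ D := by
  classical
  let φ : L.Formula (A ⊕ (ℕ ⊕ Fin n)) := rename (Sum.inr ∘ Sum.map f id) ψ
  refine ⟨{w | φ.Realize (Sum.elim (↑) w)}, definable_iff_exists_formula_sum.2 ⟨φ, rfl⟩, fun v => ?_, fun v => ?_⟩
  · simp only [φ, mem_ofPred_eq, realize_rename]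
    refine realize_congr_of_freeVarFinset ψ ?_
    rintro (a | i) ha
    · refine Eq.symm (hf a ?_)
      simp only [params, mem_ofPred_eq]
      convert ha
    · rfl
  · simp only [φ, Sat, mem_ofPred_eq, realize_rename]
    rw [← Function.comp_assoc,
      Sum.elim_comp_inr, Sum.elim_comp_map, Sum.elim_comp_map]
    rfl

omit hκ hM hμ hA hpA hμA in
theorem exists_cover_of_no_antichain {G : Type*} [Group G] (Q : Set G) (k : ℕ)
    (h : ¬ ∃ x : Fin k → G, ∀ i j, i < j → x j * (x i)⁻¹ ∉ Q) :
    ∃ (N : ℕ) (f : Fin N → G), ∀ x, ∃ i, x * (f i)⁻¹ ∈ Q := by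
  by_contra! hcon
  have : ∀ N, ∃ x : Fin N → G, ∀ i j, i < j → x j * (x i)⁻¹ ∉ Q := by
    intro N
    induction N with
    | zero => exact ⟨Fin.elim0, fun i => i.elim0⟩
    | succ N ih =>
      obtain ⟨x, hx⟩ := ih
      obtain ⟨y, hy⟩ := hcon N x
      refine ⟨Fin.snoc x y, fun i j hij => ?_⟩
      cases i using Fin.lastCases with
      | last => exact absurd hij (Fin.le_last j).not_gt
      | cast i =>
        cases j using Fin.lastCases with
        | last => simpa using hy i
        | cast j => simpa using hx i j hij
  exact h (this k)

/-- A coloring is an arbitrary function and cannot be conjugated. What transfers is the absence of k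
+ 1 elements with all quotients x_j x_i⁻¹, i < j, outside `Sol s`; a greedy choice turns this into a
finite cover, hence a new coloring. -/
theorem BoundedSystem.conjugate {r : Set (PFormula L M (Fin n))} (h : BoundedSystem p r)
    {c c' : ℕ → M} (hc : SameType L A c c') {f : M → ℕ} (hf : ∀ a ∈ Dom r, c (f a) = a) :
    BoundedSystem p (rename (Sum.map (c' ∘ f) id) '' r) := by
  have hsat : ∀ ψ ∈ r, ∀ v v', SameType L A (Sum.elim c' v') (Sum.elim c v) →
      (Sat (rename (Sum.map (c' ∘ f) id) ψ) v' ↔ Sat ψ v) := by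
    intro ψ hψ v v' hv
    obtain ⟨D, hD, h1, h2⟩ := exists_definable_of_params_subset_range c c' f A
      (ψ := ψ) fun a ha => hf a (params_subset_dom hψ ha)
    rw [h1, h2, hv.mem_iff hD]
  have hsol : ∀ s ⊆ r, ∀ v v', SameType L A (Sum.elim c' v') (Sum.elim c v) →
      (v' ∈ Sol (rename (Sum.map (c' ∘ f) id) '' s) ↔ v ∈ Sol s) := by
    intro s hs v v' hv
    simp only [Sol, mem_ofPred_eq, forall_mem_image]
    exact forall₂_congr fun ψ hψ => hsat ψ (hs hψ) v v' hv
  have hdiv : ∀ ψ ∈ r, ∃ s ⊆ r, s.Finite ∧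
      (∀ x y : Sol p, x.1 ∈ Sol (rename (Sum.map (c' ∘ f) id) '' s) →
        y.1 ∈ Sol (rename (Sum.map (c' ∘ f) id) '' s) →
        Sat (rename (Sum.map (c' ∘ f) id) ψ) (x * y⁻¹).1) := by
    intro ψ hψ
    obtain ⟨s, hs, hfin, hsψ⟩ := h.div ψ hψ
    refine ⟨s, hs, hfin, fun x y hx hy => ?_⟩
    obtain ⟨z, hz, hz'⟩ := hc.symm.exists_group_tuple hκ hM hμ hA hpA hμA ![x, y]
    refine (hsat ψ hψ _ _ (hz' 0 1)).2 (hsψ _ _ ?_ ?_)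
    · exact (hsol s hs _ _ (hz 0)).1 hx
    · exact (hsol s hs _ _ (hz 1)).1 hy
  constructor
  · rintro _ ⟨ψ, hψ, rfl⟩
    obtain ⟨s, hs, hfin, hsψ⟩ := hdiv ψ hψ
    exact ⟨_, image_mono hs, hfin.image _, hsψ⟩
  · rintro _ ⟨ψ, hψ, rfl⟩
    obtain ⟨s, hs, hfin, hsψ⟩ := hdiv ψ hψ
    obtain ⟨k, χ, hχ⟩ := h.exists_color (sol_mem_nhd hs hfin)
    obtain ⟨N, g, hg⟩ := exists_cover_of_no_antichain
      {x : Sol p | x.1 ∈ Sol (rename (Sum.map (c' ∘ f) id) '' s)} (k + 1) (by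
        rintro ⟨x, hx⟩
        obtain ⟨z, -, hz'⟩ := hc.symm.exists_group_tuple hκ hM hμ hA hpA hμA x
        obtain ⟨i, j, hij, hχij⟩ := Fintype.exists_ne_map_eq_of_card_lt (χ ∘ z) (by simp)
        rcases lt_or_gt_of_ne hij with hlt | hlt
        · exact hx i j hlt ((hsol s hs _ _ (hz' j i)).2 (hχ _ _ hχij.symm))
        · exact hx j i hlt ((hsol s hs _ _ (hz' i j)).2 (hχ _ _ hχij)))
    choose i hi using hg
    refine ⟨N, i, fun x y hxy => ?_⟩
    have := hsψ _ _ (hi x) (hxy ▸ hi y)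
    simpa using this

theorem mem_sol_of_sameType [Nonempty M] (hκ' : 2 ^ ℵ₀ < κ) {a b : Fin n → M}
    (hab : SameType L A a b) {r : Set (PFormula L M (Fin n))} (hr : BoundedSystem p r)
    (hb : ∀ r' ∈ BoundedTypes κ p, b ∈ Sol (p ∪ r')) : a ∈ Sol r := by
  by_contra hcon
  simp only [Sol, mem_ofPred_eq, not_forall] at hcon
  obtain ⟨ψ, hψr, hψ⟩ := hcon
  -- Countability lets all parameters be listed as one sequence and moved along with `a`.
  obtain ⟨r₁, -, hcount, hψ₁, h₁⟩ := hr.exists_countable hψr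
  obtain ⟨m⟩ := ‹Nonempty M›
  obtain ⟨c, hc⟩ := ((hcount.biUnion fun φ _ => (params_finite φ).countable).union
    (countable_singleton m)).exists_eq_range ⟨m, Or.inr rfl⟩
  have hdom : ∀ a ∈ Dom r₁, ∃ i, c i = a := fun a ha => by
    have : a ∈ range c := hc ▸ Or.inl ha
    exact this
  choose! f hf using hdom
  obtain ⟨c', hc'⟩ := hab.exists_seq_extension hκ.le hM hA c
  have h₁' := h₁.conjugate hκ hM hμ hA hpA hμA
    (c := c) (c' := c') (by simpa using hc'.comp Sum.inl) hf
  have hcard : #(rename (Sum.map (c' ∘ f) id) '' r₁ : Set (PFormula L M (Fin n))) ≤ ℵ₀ :=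
    (hcount.image _).le_aleph0
  have hmem := h₁'.mem_boundedTypes (κ := κ) (lt_of_le_of_lt (power_le_power_left two_ne_zero
    (mul_le_of_le le_rfl le_rfl hcard)) hκ') (hcard.trans_lt hκ)
  obtain ⟨D, hD, h1, h2⟩ := exists_definable_of_params_subset_range c c' f A
      (ψ := ψ) fun a ha => hf a (params_subset_dom hψ₁ ha)
  have hbψ := hb _ hmem _ (Or.inr ⟨ψ, hψ₁, rfl⟩)
  exact hψ ((h1 a).2 ((hc'.mem_iff hD).2 ((h2 b).1 hbψ)))

end Conjugate

/-! ### Cardinal bounds and the theorem. -/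

theorem mk_formula_over_le (A : Set M) : #(L.Formula (A ⊕ Fin n)) ≤ cardT L + #A := by
  have h1 : #(L.Formula (A ⊕ Fin n)) ≤ #(Σ k, L.BoundedFormula (A ⊕ Fin n) k) :=
    mk_le_of_injective (f := fun φ => ⟨0, φ⟩) fun φ φ' h => by simpa using h
  refine h1.trans (BoundedFormula.card_le.trans ?_)
  have hT : ℵ₀ ≤ cardT L := le_max_left _ _
  have hTA : ℵ₀ ≤ cardT L + #A := hT.trans (self_le_add_right _ _)
  refine max_le hTA (add_le_of_le hTA ?_ ?_)
  · simp only [mk_sum, lift_id, lift_uzero, mk_fin, lift_natCast]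
    refine add_le_of_le hTA ?_ ((natCast_lt_aleph0 (n := n)).le.trans hTA)
    simp
  · refine le_trans ?_ (self_le_add_right _ _)
    simp [cardT]

theorem mk_sUnion_le_of_countable {α : Type u} {S : Set (Set α)} {c : Cardinal.{u}} (hc : ℵ₀ ≤ c)
    (hS : #S ≤ c) (h : ∀ s ∈ S, s.Countable) : #(⋃₀ S) ≤ c :=
  (mk_sUnion_le S).trans (mul_le_of_le hc hS (ciSup_le' fun s => (h s.1 s.2).le_aleph0.trans hc))

/-- A family indexed by the ordinals below a successor cardinal, of which few members determine the
solutions of the whole family, already has the same solutions as one of its initial segments. -/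
theorem exists_initial_segment {c : Cardinal.{u}} (hc : ℵ₀ ≤ c) {p : Set (PFormula L M (Fin n))}
    (r : Ordinal.{u} → Set (PFormula L M (Fin n))) {S : Set (Set (PFormula L M (Fin n)))}
    (hS : S ⊆ r '' Iio (Order.succ c).ord) (hSc : #S ≤ c)
    (hsol : Sol (p ∪ ⋃₀ S) = Sol (p ∪ ⋃₀ (r '' Iio (Order.succ c).ord))) :
    ∃ α < (Order.succ c).ord,
      Sol (p ∪ ⋃ i < α, r i) = Sol (p ∪ ⋃ i < (Order.succ c).ord, r i) := by
  choose i hi hri using fun s : S => hS s.2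
  have hlim : Order.IsSuccLimit (Order.succ c).ord :=
    isSuccLimit_ord (hc.trans (Order.le_succ c))
  -- At most c indices are bounded below the regular cardinal c⁺; successors make the bound strict.
  have hα : (⨆ s, Order.succ (i s)) < (Order.succ c).ord := by
    refine Ordinal.iSup_lt_of_lt_cof ?_ fun s => hlim.succ_lt (hi s)
    rw [(isRegular_succ hc).cof_ord]
    exact Order.lt_succ_of_le hSc
  refine ⟨_, hα, Subset.antisymm ?_ ?_⟩
  · have h : Sol (p ∪ ⋃ j < ⨆ s, Order.succ (i s), r j) ⊆ Sol (p ∪ ⋃₀ S) := by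
      refine sol_anti (union_subset_union_right _ (sUnion_subset fun s hs => ?_))
      refine (hri ⟨s, hs⟩).symm.subset.trans (subset_biUnion_of_mem (u := r)
        (s := Iio (⨆ s, Order.succ (i s))) (mem_Iio.2 (Order.succ_le_iff.1 ?_)))
      exact Ordinal.le_iSup (fun s => Order.succ (i s)) ⟨s, hs⟩
    refine h.trans ?_
    rw [hsol, sUnion_image]
    rfl
  · refine sol_anti (union_subset_union_right _ ?_)
    exact biUnion_subset_biUnion_left fun j hj => lt_trans hj hα

theorem sol_qType {κ : Cardinal.{u}} {p : Set (PFormula L M (Fin n))} [Group (Sol p)]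
    (hne : (BoundedTypes κ p).Nonempty) :
    Sol (qType κ p) = ⋂ r ∈ BoundedTypes κ p, Sol (p ∪ r) := by
  ext v
  simp only [mem_iInter]
  constructor
  · exact fun hv r hr => sol_anti (union_subset_union_right _ (subset_sUnion_of_mem hr)) hv
  · rintro hv φ (hφ | ⟨r, hr, hφ⟩)
    · obtain ⟨r, hr⟩ := hne
      exact hv r hr φ (Or.inl hφ)
    · exact hv r hr φ (Or.inr hφ)

/-- If some `r` in `𝐑` defines the least subgroup, then every consequence of `q` is in `q`. -/
theorem mem_qType_of_forall {κ : Cardinal.{u}} (hκ : ℵ₀ ≤ κ) {p r : Set (PFormula L M (Fin n))}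
    [Group (Sol p)] (hr : r ∈ BoundedTypes κ p) (hsol : Sol (p ∪ r) = Sol (qType κ p))
    {φ : PFormula L M (Fin n)} (hφ : ∀ v ∈ Sol (qType κ p), Sat φ v) : φ ∈ qType κ p := by
  obtain ⟨hcard, H, himage, hH⟩ := hr
  refine Or.inr ⟨r ∪ {φ}, ⟨mk_union_lt hκ hcard (mk_lt_of_finite hκ (finite_singleton φ)), H, ?_,
    hH⟩, Or.inr rfl⟩
  rw [himage, ← union_assoc, sol_union (p ∪ r), eq_comm, inter_eq_left, hsol]
  rintro v hv _ rfl
  exact hφ v hv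

end Dsg

open Dsg in
theorem lemma1p1
    (L : FirstOrder.Language.{u, u}) (T : L.Theory) (hT : T.IsComplete) (hdep : Dsg.Dependent T)
    (M : Type u) [L.Structure M] [Nonempty M] [M ⊨ T]
    (κ : Cardinal.{u}) (hκ : 2 ^ (Dsg.cardT L ^ ℵ₀) < κ) (hM : Dsg.IsSaturated L M κ)
    (n : ℕ) (p : Set (Dsg.PFormula L M (Fin n))) (hp : #p < κ)
    [Group (Dsg.Sol p)]
    (μ : Dsg.PFormula L M (Fin n ⊕ Fin n ⊕ Fin n)) (hμ : Dsg.DefinesMul p μ) :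
    -- `q(M)` is a subgroup of `p(M)`, with two bounds on its index
    (∃ H : Subgroup (Dsg.Sol p),
      Subtype.val '' (H : Set (Dsg.Sol p)) = Dsg.Sol (Dsg.qType κ p) ∧
      #(Dsg.Sol p ⧸ H) ≤ 2 ^ (Dsg.cardT L ^ ℵ₀) ∧
      #(Dsg.Sol p ⧸ H) ≤ 2 ^ (#(Dsg.Dom p) + Dsg.cardT L)) ∧
    -- `q` is `p` together with few further formulas, up to equivalence
    (∃ q' ⊆ Dsg.qType κ p, #q' ≤ Dsg.cardT L ^ ℵ₀ ∧
      Dsg.TypeEquiv (Dsg.qType κ p) (p ∪ q')) ∧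
    -- the intersection of all type-definable subgroups of bounded index is again one of them
    (∃ r ∈ Dsg.BoundedTypes κ p,
      Dsg.Sol (p ∪ r) = ⋂ r' ∈ Dsg.BoundedTypes κ p, Dsg.Sol (p ∪ r')) ∧
    -- if the multiplication is definable over `Dom(p)`, so is `q`, up to equivalence
    (Dsg.params μ ⊆ Dsg.Dom p →
      ∃ q' ⊆ Dsg.qType κ p, Dsg.Dom q' ⊆ Dsg.Dom p ∧
        #q' ≤ Dsg.cardT L + #(Dsg.Dom p) ∧ Dsg.TypeEquiv (Dsg.qType κ p) q') ∧
    -- long sequences in `𝐑` stabilize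
    (∀ r : Ordinal.{u} → Set (Dsg.PFormula L M (Fin n)),
      (∀ i < (Order.succ (Dsg.cardT L ^ ℵ₀)).ord, r i ∈ Dsg.BoundedTypes κ p) →
      ∃ α < (Order.succ (Dsg.cardT L ^ ℵ₀)).ord,
        Dsg.Sol (p ∪ ⋃ i < α, r i) =
          Dsg.Sol (p ∪ ⋃ i < (Order.succ (Dsg.cardT L ^ ℵ₀)).ord, r i)) := by
  have hT : ℵ₀ ≤ cardT L := le_max_left _ _
  have hTT : cardT L ≤ cardT L ^ ℵ₀ := self_le_power _ one_lt_aleph0.le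
  have h2T : (2 : Cardinal.{u}) ^ cardT L ≤ 2 ^ (cardT L ^ ℵ₀) := power_le_power_left two_ne_zero hTT
  have h2κ : (2 : Cardinal.{u}) ^ cardT L < κ := h2T.trans_lt hκ
  have hTκ : cardT L < κ := (cantor _).trans h2κ
  have hκ₀ : ℵ₀ < κ := hT.trans_lt hTκ
  have hκc : (2 : Cardinal.{u}) ^ ℵ₀ < κ := (power_le_power_left two_ne_zero hT).trans_lt h2κ
  have hpow : ∀ {r : Set (PFormula L M (Fin n))}, #r ≤ cardT L →
      (2 : Cardinal.{u}) ^ (ℵ₀ * #r) ≤ 2 ^ cardT L := fun hr =>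
    power_le_power_left two_ne_zero (mul_le_of_le hT hT hr)
  have hsys : ∀ r ∈ BoundedTypes κ p, BoundedSystem p r := fun r hr =>
    boundedSystem_of_mem hM hκ₀ hp hμ hr
  have hmem : ∀ {r : Set (PFormula L M (Fin n))}, BoundedSystem p r → #r ≤ cardT L →
      r ∈ BoundedTypes κ p := fun h hr =>
    h.mem_boundedTypes ((hpow hr).trans_lt h2κ) (hr.trans_lt hTκ)
  -- few countable systems already define `q(M)`
  let R : Set (Set (PFormula L M (Fin n))) := {r | BoundedSystem p r ∧ r.Countable}
  obtain ⟨S, hSR, hS, hSsol⟩ := hdep.exists_small_subfamily (M := M) R fun r hr => hr.1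
  have hRq : p ∪ ⋃₀ R = qType κ p := by
    refine Subset.antisymm (union_subset_union_right _ (sUnion_subset_sUnion fun r hr =>
      hmem hr.1 (hr.2.le_aleph0.trans hT))) (union_subset_union_right _ ?_)
    rintro ψ ⟨r, hr, hψ⟩
    obtain ⟨r₁, -, hcount, hψ₁, h₁⟩ := (hsys r hr).exists_countable hψ
    exact ⟨r₁, ⟨h₁, hcount⟩, hψ₁⟩
  rw [hRq] at hSsol
  have hSsys : BoundedSystem p (⋃₀ S) := BoundedSystem.sUnion fun r hr => (hSR hr).1
  have hScard : #(⋃₀ S) ≤ cardT L := mk_sUnion_le_of_countable hT hS fun r hr => (hSR hr).2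
  have hSmem : ⋃₀ S ∈ BoundedTypes κ p := hmem hSsys hScard
  have hSq : ⋃₀ S ⊆ qType κ p := (subset_sUnion_of_mem hSmem).trans subset_union_right
  have hequiv : ∀ {Φ : Set (PFormula L M (Fin n))}, #(Dom Φ) < κ → Φ ⊆ qType κ p →
      Sol Φ ⊆ Sol (qType κ p) → TypeEquiv (qType κ p) Φ := by
    intro Φ hcard hsub hsol
    refine ⟨fun φ hφ => ⟨{φ}, by simpa using hsub hφ, finite_singleton φ, fun v hv => hv φ rfl⟩,
      fun φ hφ => hM.entails hκ₀ hcard fun v hv => hsol hv φ hφ⟩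
  refine ⟨⟨hSsys.subgroup, ?_, ?_, ?_⟩, ⟨⋃₀ S, hSq, hScard.trans hTT, ?_⟩,
    ⟨⋃₀ S, hSmem, ?_⟩, fun hμp => ?_, fun r hr => ?_⟩
  · rw [hSsys.image_subgroup, hSsol]
  · exact hSsys.mk_quotient_le.trans ((hpow hScard).trans h2T)
  · exact hSsys.mk_quotient_le.trans ((hpow hScard).trans
      (power_le_power_left two_ne_zero (self_le_add_left _ _)))
  · exact hequiv (mk_dom_lt hκ₀ (mk_union_lt hκ₀.le hp (hScard.trans_lt hTκ)))
      (union_subset subset_union_left hSq) hSsol.subset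
  · rw [hSsol, sol_qType ⟨_, hSmem⟩]
  · have hDp : #(Dom p) < κ := mk_dom_lt hκ₀ hp
    have hdom : Dom (range (ofFormula (Dom p)) ∩ qType κ p) ⊆ Dom p := by
      refine iUnion₂_subset ?_
      rintro _ ⟨⟨φ, rfl⟩, -⟩
      exact params_ofFormula _ φ
    -- The witness is the set of all formulas of q over Dom(p).
    refine ⟨_, inter_subset_right, hdom, (mk_le_mk_of_subset inter_subset_left).trans
      (mk_range_le.trans (mk_formula_over_le _)), ?_⟩
    refine hequiv ((mk_le_mk_of_subset hdom).trans_lt hDp) inter_subset_right fun a ha => ?_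
    have hcons : ∀ D : Set (Fin n → M), (Dom p).Definable L D → Sol (qType κ p) ⊆ D → a ∈ D := by
      intro D hD hsub
      obtain ⟨φ, hφ⟩ := exists_ofFormula hD
      exact (hφ a).1 (ha _ ⟨⟨φ, rfl⟩, mem_qType_of_forall hκ₀.le hSmem hSsol fun v hv =>
        (hφ v).2 (hsub hv)⟩)
    -- an element of `q(M)` with the same type as `a` over `Dom(p)`
    obtain ⟨b, hbq, hab⟩ : ∃ b ∈ Sol (qType κ p), SameType L (Dom p) a b := by
      let F : Filter (Fin n → M) :=
        { sets := {E | ∃ D, (Dom p).Definable L D ∧ a ∈ D ∧ D ∩ Sol (qType κ p) ⊆ E}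
          univ_sets := ⟨univ, definable_univ, mem_univ _, subset_univ _⟩
          sets_of_superset := by
            rintro E E' ⟨D, h1, h2, h3⟩ h
            exact ⟨D, h1, h2, h3.trans h⟩
          inter_sets := by
            rintro E E' ⟨D, h1, h2, h3⟩ ⟨D', h1', h2', h3'⟩
            exact ⟨D ∩ D', h1.inter h1', ⟨h2, h2'⟩, fun v hv =>
              ⟨h3 ⟨hv.1.1, hv.2⟩, h3' ⟨hv.1.2, hv.2⟩⟩⟩ }
      -- Otherwise some `D` over Dom(p) containing `a` misses q(M), so its complement is a
      -- consequence of q that `a` must satisfy.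
      have : Filter.NeBot F := by
        refine ⟨fun hbot => ?_⟩
        obtain ⟨D, h1, h2, h3⟩ := (hbot ▸ Filter.mem_bot : ∅ ∈ F)
        exact hcons Dᶜ h1.compl (fun v hv hvD => h3 ⟨hvD, hv⟩) h2
      -- The small type p ∪ ⋃₀ S stands in for q, whose parameter set need not have size below κ.
      obtain ⟨b, hb⟩ := hM.exists_realization F id (A := Dom p ∪ Dom (p ∪ ⋃₀ S))
        (mk_union_lt hκ₀.le hDp
          (mk_dom_lt hκ₀ (mk_union_lt hκ₀.le hp (hScard.trans_lt hTκ))))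
      refine ⟨b, hSsol ▸ fun φ hφ => hb {v | Sat φ v}
        (definable_sat_of_subset ((params_subset_dom hφ).trans subset_union_right)) ?_,
        fun D hD haD => hb D (hD.mono subset_union_left) ⟨D, hD, haD, inter_subset_left⟩⟩
      refine ⟨univ, definable_univ, mem_univ _, fun v hv => ?_⟩
      rw [← hSsol] at hv
      exact hv.2 φ hφ
    rw [← hSsol, sol_union]
    refine ⟨fun φ hφ => hab.symm {v | Sat φ v} (definable_sat_of_subset (params_subset_dom hφ))
      (hbq φ (Or.inl hφ)), ?_⟩
    rw [sol_qType ⟨_, hSmem⟩, mem_iInter₂] at hbq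
    exact mem_sol_of_sameType hκ₀ hM hμ hDp subset_rfl hμp hκc hab hSsys hbq
  · obtain ⟨S', hS'r, hS', hS'sol⟩ := hdep.exists_small_subfamily (M := M)
      (r '' Iio (Order.succ (cardT L ^ ℵ₀)).ord) (p := p) (by
        rintro _ ⟨i, hi, rfl⟩
        exact hsys _ (hr i hi))
    exact exists_initial_segment (hT.trans hTT) r hS'r (hS'.trans hTT) hS'sol

end
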